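/- For $m\ge 1$ let $D$ be the $m\times m$ matrix with $D_{ii}=1$, $D_{i+1,i}=-1$ and all other entries $0$. For a matrix $A$ with $k$ columns, $\sigma_{\min}(A)$ denotes its smallest singular value, i.e. the square root of the smallest eigenvalue of $A^{T}A$. An $r$-th order Sobolev dual of an $m\times k$ matrix $E$ is a left inverse $F$ of $E$ for which the $\ell_2\to\ell_2$ operator norm $\|FD^r\|_{\mathrm{op}}$ is minimal among all left inverses of $E$. Given $\delta>0$ and $y\in\mathbb{R}^m$, the greedy $r$-th order $\Sigma\Delta$ quantization of $y$ with alphabet $\delta\mathbb{Z}$ is a sequence $q\in(\delta\mathbb{Z})^m$, with state sequence $u\in\mathbb{R}^m$ and $u_j:=0$ for $j\le 0$, such that for $j=1,\dots,m$ $$(\Delta^r u)_j=\sum_{i=0}^r(-1)^i\binom{r}{i}u_{j-i}=y_j-q_j,\qquad q_j\in\arg\min_{a\in\delta\mathbb{Z}}\Big|\sum_{i=1}^r(-1)^{i-1}\binom{r}{i}u_{j-i}+y_j-a\Big| .$$ **Theorem.** For every integer $r\ge1$ there are positive constants $c,c',c_1,C$ depending only on $r$ such that the following holds. Let $\alpha\in(0,1)$,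 let $1\le k\le m$ be integers, put $\lambda=m/k$, and suppose that $\lambda\ge c(\log m)^{1/(1-\alpha)}$. Let $E$ be an $m\times k$ random matrix whose entries are i.i.d. $\mathcal{N}(0,1)$. Then with probability at least $1-\exp(-c'm\lambda^{-\alpha})$, $$\sigma_{\min}(D^{-r}E)\ \ge\ c_1\,\lambda^{\alpha(r-\frac12)}\sqrt m .$$ Moreover, whenever this inequality holds, the matrix $(D^{-r}E)^{\dagger}D^{-r}$, where $A^\dagger=(A^{T}A)^{-1}A^{T}$, is an $r$-th order Sobolev dual of $E$, and for every $r$-th order Sobolev dual $F$ of $E$, every $\delta>0$, every $x\in\mathbb{R}^k$ and every greedy $r$-th order $\Sigma\Delta$ quantization $q$ of $y=Ex$ with alphabet $\delta\mathbb{Z}$, the reconstruction $\hat x=Fq$ satisfies $$\|x-\hat x\|_2\ \le\ C\,\lambda^{-\alpha(r-\frac12)}\,\delta .$$ -/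

import Mathlib

open MeasureTheory ProbabilityTheory

noncomputable section

namespace SigmaDelta

/-- The `m × m` difference matrix: `1` on the diagonal, `-1` on the first subdiagonal. -/
def D (m : ℕ) : Matrix (Fin m) (Fin m) ℝ :=
  Matrix.of fun i j => if i = j then 1 else if (i : ℕ) = (j : ℕ) + 1 then -1 else 0

/-- The smallest singular value `σ_k(A)` of a matrix `A` with `k` columns (Mathlib indexes the
singular values, which are the decreasingly ordered square roots of the eigenvalues of `Aᵀ A`,
from `0`). It is meant for `1 ≤ k`. -/
def sigmaMin {m k : ℕ} (A : Matrix (Fin m) (Fin k) ℝ) : ℝ :=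
  (Matrix.toEuclideanLin A).singularValues (k - 1)

/-- The Euclidean norm of a vector. -/
def norm2 {n : ℕ} (v : Fin n → ℝ) : ℝ := ‖WithLp.toLp 2 v‖

open scoped Matrix.Norms.L2Operator in
/-- The `ℓ₂ → ℓ₂` operator norm of a matrix. -/
def opNorm {m n : ℕ} (A : Matrix (Fin m) (Fin n) ℝ) : ℝ := ‖A‖

/-- `(Aᵀ A)⁻¹ Aᵀ`, the Moore-Penrose inverse of a matrix `A` of full column rank. -/
def pinv {m k : ℕ} (A : Matrix (Fin m) (Fin k) ℝ) : Matrix (Fin k) (Fin m) ℝ :=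
  (A.transpose * A)⁻¹ * A.transpose

/-- `F` is an `r`-th order Sobolev dual of the frame `E`: a left inverse of `E` for which the
operator norm of `F D^r` is minimal among all left inverses of `E`. -/
def IsSobolevDual (r : ℕ) {m k : ℕ} (E : Matrix (Fin m) (Fin k) ℝ)
    (F : Matrix (Fin k) (Fin m) ℝ) : Prop :=
  F * E = 1 ∧
    ∀ G : Matrix (Fin k) (Fin m) ℝ, G * E = 1 → opNorm (F * D m ^ r) ≤ opNorm (G * D m ^ r)

/-- The `r`-th order Sobolev dual given by the explicit formula `F D^r = (D^{-r} E)^†`. -/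
def sobolevDual (r : ℕ) {m k : ℕ} (E : Matrix (Fin m) (Fin k) ℝ) :
    Matrix (Fin k) (Fin m) ℝ :=
  pinv ((D m ^ r)⁻¹ * E) * (D m ^ r)⁻¹

/-- `u_{j-i}`, where the entries of `u` before the first one (the initial conditions) are `0`. -/
def past {m : ℕ} (u : Fin m → ℝ) (j : Fin m) (i : ℕ) : ℝ :=
  if i ≤ (j : ℕ) then u ⟨(j : ℕ) - i, lt_of_le_of_lt (Nat.sub_le _ _) j.isLt⟩ else 0

/-- The `r`-th order backward difference `(Δ^r u)_j`, with zero initial conditions. -/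
def diffPow (r : ℕ) {m : ℕ} (u : Fin m → ℝ) (j : Fin m) : ℝ :=
  ∑ i ∈ Finset.range (r + 1), (-1 : ℝ) ^ i * (r.choose i : ℝ) * past u j i

/-- The number `∑_{i=1}^r (-1)^{i-1} (r choose i) u_{j-i} + y_j` that the greedy rule rounds. -/
def greedyInput (r : ℕ) {m : ℕ} (y u : Fin m → ℝ) (j : Fin m) : ℝ :=
  (∑ i ∈ Finset.Icc 1 r, (-1 : ℝ) ^ (i - 1) * (r.choose i : ℝ) * past u j i) + y j

/-- `q` is an output, with state sequence `u`, of the greedy `r`-th order Sigma-Delta quantizer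
with alphabet `δ ℤ` and zero initial conditions applied to `y`. (Ties may be broken in any way.) -/
structure IsGreedyOutput (r : ℕ) (δ : ℝ) {m : ℕ} (y q u : Fin m → ℝ) : Prop where
  /-- The governing equation `(Δ^r u)_j = y_j - q_j`. -/
  state_eq : ∀ j, diffPow r u j = y j - q j
  /-- The output lies in the alphabet `δ ℤ`. -/
  mem_alphabet : ∀ j, ∃ n : ℤ, q j = δ * n
  /-- `q_j` is an element of the alphabet nearest to the greedy input. -/
  greedy : ∀ j, ∀ n : ℤ, |greedyInput r y u j - q j| ≤ |greedyInput r y u j - δ * n|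

end SigmaDelta

end

/-! The Gaussian matrix is compressed to its smooth part. Choose `W` with `l` orthonormal rows, each
a B-spline-like bump on its own block of length `(r+1)s`. Summation by parts gives `‖W D^r‖ ≤ K`,
with `K` of order `s^{-r}` (`exists_orthonormal_smooth_rows`). Since `W E = (W D^r)(D^{-r} E)`, it
follows that `σ_min(D^{-r}E) ≥ σ_min(W E) / K` (`le_sigmaMin_inv_D_pow_mul`).

`W E` is again a standard Gaussian matrix, of size `l × k`. A union bound over a crude grid gives
`σ_min(W E) ≥ const · √l` outside an event of probability `exp(-l/4)`, as soon as `l ≥ 9 k log m`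
(`measureReal_exists_norm2_mulVec_lt_of_log_le`). Taking `s` of order `λ^α` and `l` of order `m/s`
yields `s^r √l`, of order `λ^{α(r-1/2)} √m`; the hypothesis on `λ` is what makes this `l` large
enough.

The reconstruction part is deterministic: `x - Fq = (F D^r) u`, the greedy state satisfies `|u_j| ≤
δ/2`, and the minimal `‖F D^r‖` is at most `1/σ_min(D^{-r}E)` (`sobolevDual_reconstruction`). -/

noncomputable section

namespace SigmaDelta

/-! ### Gaussian vectors and chi-squared tails. -/

section Gaussian

variable {Ω : Type*} [MeasurableSpace Ω] {P : Measure Ω}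

/-- A linear combination of independent standard Gaussians is Gaussian. -/
theorem hasLaw_sum_mul_gaussian [IsProbabilityMeasure P] {ι : Type*} [Fintype ι] {g : ι → Ω → ℝ}
    (hg : ∀ p, HasLaw (g p) (gaussianReal 0 1) P) (hi : iIndepFun g P) (c : ι → ℝ) :
    HasLaw (fun ω => ∑ p, c p * g p ω) (gaussianReal 0 (∑ p, (c p ^ 2).toNNReal)) P := by
  have hgm : ∀ p, AEMeasurable (g p) P := fun p => (hg p).aemeasurable
  have hX : ∀ p, HasLaw (fun ω => c p * g p ω) (gaussianReal 0 ((c p ^ 2).toNNReal)) P := by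
    intro p
    have := gaussianReal_const_mul (hg p) (c p)
    convert this using 2
    · simp
    · ext; simp [Real.coe_toNNReal _ (sq_nonneg (c p))]
  have hXi : iIndepFun (fun p ω => c p * g p ω) P :=
    hi.comp (fun p x => c p * x) (fun p => by fun_prop)
  refine ⟨by fun_prop, ?_⟩
  have : IsProbabilityMeasure (P.map (fun ω => ∑ p, c p * g p ω)) :=
    Measure.isProbabilityMeasure_map (by fun_prop)
  refine Measure.ext_of_charFun ?_
  rw [hXi.charFun_map_fun_sum_eq_prod (fun p => (hX p).aemeasurable)]
  ext t
  simp_rw [Finset.prod_apply, fun p => (hX p).map_eq, charFun_gaussianReal]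
  rw [← Complex.exp_sum]
  congr 1
  push_cast
  rw [Finset.sum_sub_distrib, Finset.sum_mul, Finset.sum_div]
  simp

/-- Orthonormal linear combinations of independent standard Gaussians are independent standard
Gaussians. -/
theorem gaussian_of_orthonormal [IsProbabilityMeasure P] {ι κ : Type*} [Fintype ι] [Fintype κ] [DecidableEq κ]
    {g : ι → Ω → ℝ} (hg : ∀ p, HasLaw (g p) (gaussianReal 0 1) P) (hi : iIndepFun g P)
    {W : κ → ι → ℝ} (hW : ∀ a b, ∑ p, W a p * W b p = if a = b then 1 else 0) :
    (∀ a, HasLaw (fun ω => ∑ p, W a p * g p ω) (gaussianReal 0 1) P) ∧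
      iIndepFun (fun a ω => ∑ p, W a p * g p ω) P := by
  have hgm : ∀ p, AEMeasurable (g p) P := fun p => (hg p).aemeasurable
  have h1 : ∀ a, HasLaw (fun ω => ∑ p, W a p * g p ω) (gaussianReal 0 1) P := by
    intro a
    convert hasLaw_sum_mul_gaussian hg hi (W a) using 2
    ext
    push_cast
    have := hW a a
    simp only [if_true] at this
    rw [← this]
    exact Finset.sum_congr rfl fun p _ => by
      rw [Real.coe_toNNReal _ (sq_nonneg _), sq]
  refine ⟨h1, ?_⟩
  rw [iIndepFun_iff_charFun_pi (fun a => (h1 a).aemeasurable)]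
  intro t
  have e1 : charFun (P.map (fun ω => WithLp.toLp 2 (fun a => ∑ p, W a p * g p ω))) t =
      charFun (P.map (fun ω => ∑ p, (∑ a, t a * W a p) * g p ω)) 1 := by
    rw [charFun_apply, charFun_apply, integral_map (by fun_prop) (by fun_prop),
      integral_map (by fun_prop) (by fun_prop)]
    refine integral_congr_ae (Filter.Eventually.of_forall fun ω => ?_)
    simp only [PiLp.inner_apply, RCLike.inner_apply, conj_trivial, one_mul]
    congr 3
    simp_rw [Finset.mul_sum, Finset.sum_mul]
    rw [Finset.sum_comm]
    exact Finset.sum_congr rfl fun p _ => Finset.sum_congr rfl fun a _ => by ring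
  rw [e1, (hasLaw_sum_mul_gaussian hg hi _).map_eq]
  simp_rw [fun a => (h1 a).map_eq, charFun_gaussianReal]
  rw [← Complex.exp_sum]
  congr 1
  -- Orthonormality enters here as `‖Wᵀt‖² = ‖t‖²`, which makes the joint characteristic function
  -- factor.
  have key : ∑ p, (∑ a, t a * W a p) ^ 2 = ∑ a, t a ^ 2 := by
    simp_rw [sq, Finset.sum_mul_sum]
    rw [Finset.sum_comm]
    refine Finset.sum_congr rfl fun a _ => ?_
    rw [Finset.sum_comm]
    have : ∀ b, ∑ p, t a * W a p * (t b * W b p) = t a * t b * if a = b then 1 else 0 := by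
      intro b
      rw [← hW a b, Finset.mul_sum]
      exact Finset.sum_congr rfl fun p _ => by ring
    simp [this]
  have key2 : ((∑ p, ((∑ a, t a * W a p) ^ 2).toNNReal : NNReal) : ℝ) = ∑ a, t a ^ 2 := by
    rw [← key]
    push_cast
    exact Finset.sum_congr rfl fun p _ => Real.coe_toNNReal _ (sq_nonneg _)
  have key3 : (((∑ p, ((∑ a, t a * W a p) ^ 2).toNNReal : NNReal) : ℝ) : ℂ) =
      ∑ a, (t a : ℂ) ^ 2 := by
    rw [key2]; push_cast; rfl
  rw [key3]
  simp [Finset.sum_div]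

theorem integral_exp_mul_sq_gaussianReal {t : ℝ} (ht : t < 1 / 2) :
    Integrable (fun x => Real.exp (t * x ^ 2)) (gaussianReal 0 1) ∧
      ∫ x, Real.exp (t * x ^ 2) ∂(gaussianReal 0 1) = (√(1 - 2 * t))⁻¹ := by
  have hb : 0 < 1 / 2 - t := by linarith
  have e : ∀ x : ℝ, gaussianPDFReal 0 1 x * Real.exp (t * x ^ 2) =
      (√(2 * Real.pi))⁻¹ * Real.exp (-(1 / 2 - t) * x ^ 2) := by
    intro x
    simp only [gaussianPDFReal, NNReal.coe_one, sub_zero, mul_one]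
    rw [mul_assoc, ← Real.exp_add]
    congr 2
    ring
  constructor
  · rw [gaussianReal_of_var_ne_zero _ one_ne_zero, gaussianPDF_def,
      integrable_withDensity_iff_integrable_smul₀' (by fun_prop) (by simp)]
    simp_rw [ENNReal.toReal_ofReal (gaussianPDFReal_nonneg _ _ _), smul_eq_mul, e]
    exact (integrable_exp_neg_mul_sq hb).const_mul _
  · rw [integral_gaussianReal_eq_integral_smul one_ne_zero]
    simp_rw [smul_eq_mul, e]
    rw [integral_const_mul, integral_gaussian, ← Real.sqrt_inv, ← Real.sqrt_mul (by positivity),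
      ← Real.sqrt_inv]
    congr 1
    have : (1 - 2 * t) ≠ 0 := by linarith
    field_simp

theorem mgf_sum_sq_gaussian {κ : Type*} [Fintype κ] {X : κ → Ω → ℝ}
    (hX : ∀ a, HasLaw (X a) (gaussianReal 0 1) P) (hi : iIndepFun X P) {t : ℝ} (ht : t < 1 / 2) :
    mgf (fun ω => ∑ a, X a ω ^ 2) P t = (√(1 - 2 * t))⁻¹ ^ Fintype.card κ := by
  have hm : ∀ a, AEMeasurable (X a) P := fun a => (hX a).aemeasurable
  have h2 : iIndepFun (fun a ω => X a ω ^ 2) P := hi.comp (fun _ x => x ^ 2) (by fun_prop)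
  have h3 := h2.mgf_sum₀ (t := t) (by fun_prop) Finset.univ
  have h4 : (∑ a, fun ω => X a ω ^ 2) = fun ω => ∑ a, X a ω ^ 2 := by
    ext; simp
  rw [h4] at h3
  rw [h3]
  have : ∀ a, mgf (fun ω => X a ω ^ 2) P t = (√(1 - 2 * t))⁻¹ := by
    intro a
    rw [← (integral_exp_mul_sq_gaussianReal ht).2]
    exact (hX a).integral_comp (f := fun x => Real.exp (t * x ^ 2)) (by fun_prop)
  simp [this]

theorem integrable_exp_sum_sq_gaussian {κ : Type*} [Fintype κ] {X : κ → Ω → ℝ}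
    (hX : ∀ a, HasLaw (X a) (gaussianReal 0 1) P) (hi : iIndepFun X P) {t : ℝ} (ht : t < 1 / 2) :
    Integrable (fun ω => Real.exp (t * ∑ a, X a ω ^ 2)) P := by
  -- A nonintegrable function has integral `0` by convention, whereas this integral has just been
  -- computed to be positive.
  refine not_imp_comm.1 integral_undef ?_
  have := mgf_sum_sq_gaussian hX hi ht
  rw [mgf] at this
  rw [this]
  have : 0 < 1 - 2 * t := by linarith
  positivity

/-- Lower tail of a chi-squared variable. -/
theorem measureReal_sum_sq_le [IsProbabilityMeasure P] {κ : Type*} [Fintype κ] {X : κ → Ω → ℝ}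
    (hX : ∀ a, HasLaw (X a) (gaussianReal 0 1) P) (hi : iIndepFun X P) {s : ℝ} (hs : 0 < s) :
    P.real {ω | ∑ a, X a ω ^ 2 ≤ s ^ 2 * Fintype.card κ} ≤ (2 * s) ^ Fintype.card κ := by
  set n := Fintype.card κ
  have ht : -(1 / (2 * s ^ 2)) ≤ 0 := by
    have : 0 < 1 / (2 * s ^ 2) := by positivity
    linarith
  -- With this Chernoff parameter the exponential costs `e^{1/2} ≤ 2` per coordinate and the moment
  -- generating function gains a factor at most `s`.
  refine (measure_le_le_exp_mul_mgf (t := -(1 / (2 * s ^ 2))) (s ^ 2 * n) ht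
    (integrable_exp_sum_sq_gaussian hX hi (by linarith))).trans ?_
  rw [mgf_sum_sq_gaussian hX hi (by linarith)]
  have e1 : -(-(1 / (2 * s ^ 2))) * (s ^ 2 * n) = n * (1 / 2) := by
    field_simp
  rw [e1, Real.exp_nat_mul, ← mul_pow]
  refine pow_le_pow_left₀ (by positivity) ?_ _
  have h1 : Real.exp (1 / 2) ≤ 2 := by
    have h := Real.exp_one_lt_d9
    have h2 : Real.exp (1 / 2) ^ 2 = Real.exp 1 := by rw [← Real.exp_nat_mul]; norm_num
    nlinarith [Real.exp_pos (1 / 2)]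
  have h2 : (√(1 - 2 * -(1 / (2 * s ^ 2))))⁻¹ ≤ s := by
    have : 1 - 2 * -(1 / (2 * s ^ 2)) = 1 + (s ^ 2)⁻¹ := by field_simp; ring
    rw [this, inv_le_comm₀ (by positivity) hs]
    refine Real.le_sqrt_of_sq_le ?_
    rw [inv_pow]
    linarith
  gcongr

/-- Upper tail of a chi-squared variable. -/
theorem measureReal_le_sum_sq [IsProbabilityMeasure P] {κ : Type*} [Fintype κ] {X : κ → Ω → ℝ}
    (hX : ∀ a, HasLaw (X a) (gaussianReal 0 1) P) (hi : iIndepFun X P) :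
    P.real {ω | 8 * (Fintype.card κ : ℝ) ≤ ∑ a, X a ω ^ 2} ≤ Real.exp (-Fintype.card κ) := by
  set n := Fintype.card κ
  refine (measure_ge_le_exp_mul_mgf (t := 1 / 4) (8 * n) (by norm_num)
    (integrable_exp_sum_sq_gaussian hX hi (by norm_num))).trans ?_
  rw [mgf_sum_sq_gaussian hX hi (by norm_num)]
  have e1 : -(1 / 4 : ℝ) * (8 * n) = n * (-2) := by ring
  have e2 : -(n : ℝ) = n * (-1) := by ring
  rw [e1, e2, Real.exp_nat_mul, Real.exp_nat_mul, ← mul_pow]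
  refine pow_le_pow_left₀ (by positivity) ?_ _
  have h1 : (√(1 - 2 * (1 / 4)))⁻¹ ≤ Real.exp 1 := by
    have h := Real.exp_one_gt_d9
    refine le_trans ?_ h.le
    rw [inv_le_comm₀ (by positivity) (by norm_num)]
    exact Real.le_sqrt_of_sq_le (by norm_num)
  calc Real.exp (-2) * (√(1 - 2 * (1 / 4)))⁻¹ ≤ Real.exp (-2) * Real.exp 1 := by gcongr
    _ = Real.exp (-1) := by rw [← Real.exp_add]; norm_num

end Gaussian

/-! ### Euclidean norms and contractions. -/

theorem norm2_sq {n : ℕ} (v : Fin n → ℝ) : norm2 v ^ 2 = ∑ i, v i ^ 2 := by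
  simp [norm2, EuclideanSpace.norm_sq_eq]

theorem norm2_nonneg {n : ℕ} (v : Fin n → ℝ) : 0 ≤ norm2 v := norm_nonneg _

theorem norm2_add_le {n : ℕ} (v w : Fin n → ℝ) : norm2 (v + w) ≤ norm2 v + norm2 w := by
  simpa [norm2] using norm_add_le (WithLp.toLp 2 v) (WithLp.toLp 2 w)

theorem norm2_smul {n : ℕ} (c : ℝ) (v : Fin n → ℝ) : norm2 (c • v) = |c| * norm2 v := by
  simp [norm2, norm_smul]

theorem norm2_neg {n : ℕ} (v : Fin n → ℝ) : norm2 (-v) = norm2 v := by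
  simp [norm2]

theorem norm2_pos {n : ℕ} {v : Fin n → ℝ} (hv : v ≠ 0) : 0 < norm2 v := by
  simpa [norm2] using hv

theorem norm2_le_of_sq_le {n : ℕ} {v : Fin n → ℝ} {R : ℝ} (hR : 0 ≤ R)
    (h : ∑ i, v i ^ 2 ≤ R ^ 2) : norm2 v ≤ R :=
  abs_le_of_sq_le_sq' (by rwa [norm2_sq]) hR |>.2

theorem abs_apply_le_norm2 {n : ℕ} (v : Fin n → ℝ) (i : Fin n) : |v i| ≤ norm2 v := by
  refine abs_le_of_sq_le_sq ?_ (norm2_nonneg v)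
  rw [norm2_sq]
  exact Finset.single_le_sum (f := fun i => v i ^ 2) (fun _ _ => sq_nonneg _) (Finset.mem_univ i)

/-- The operator norm is bounded by the Frobenius norm. -/
theorem norm2_mulVec_sq_le {m k : ℕ} (A : Matrix (Fin m) (Fin k) ℝ) (x : Fin k → ℝ) :
    norm2 (A.mulVec x) ^ 2 ≤ (∑ p : Fin m × Fin k, A p.1 p.2 ^ 2) * norm2 x ^ 2 := by
  rw [norm2_sq, norm2_sq, Fintype.sum_prod_type, Finset.sum_mul]
  exact Finset.sum_le_sum fun i _ => Finset.sum_mul_sq_le_sq_mul_sq Finset.univ (A i) x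

/-- A matrix with orthonormal rows is a contraction. -/
theorem norm2_mulVec_le_of_mul_transpose {l m : ℕ} {W : Matrix (Fin l) (Fin m) ℝ}
    (hW : W * W.transpose = 1) (v : Fin m → ℝ) : norm2 (W.mulVec v) ≤ norm2 v := by
  refine norm2_le_of_sq_le (norm2_nonneg v) ?_
  have h1 : ∑ i, (W.mulVec v) i ^ 2 = W.mulVec v ⬝ᵥ W.mulVec v := by
    simp [dotProduct, sq]
  have h2 : norm2 v ^ 2 = v ⬝ᵥ v := by
    rw [norm2_sq]; simp [dotProduct, sq]
  have h3 : norm2 (v - W.transpose.mulVec (W.mulVec v)) ^ 2 = v ⬝ᵥ v - W.mulVec v ⬝ᵥ W.mulVec v := by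
    rw [norm2_sq]
    have e1 : ∑ i, (v - W.transpose.mulVec (W.mulVec v)) i ^ 2 =
      (v - W.transpose.mulVec (W.mulVec v)) ⬝ᵥ (v - W.transpose.mulVec (W.mulVec v)) := by
      simp [dotProduct, sq]
    have e2 : v ⬝ᵥ W.transpose.mulVec (W.mulVec v) = W.mulVec v ⬝ᵥ W.mulVec v := by
      rw [Matrix.dotProduct_mulVec, Matrix.vecMul_transpose]
    have e3 : W.transpose.mulVec (W.mulVec v) ⬝ᵥ W.transpose.mulVec (W.mulVec v) =
        W.mulVec v ⬝ᵥ W.mulVec v := by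
      rw [Matrix.dotProduct_mulVec, Matrix.vecMul_transpose, Matrix.mulVec_mulVec, hW,
        Matrix.one_mulVec]
    rw [e1, sub_dotProduct, dotProduct_sub, dotProduct_sub, e2, e3,
      dotProduct_comm (W.transpose.mulVec _) v, e2]
    ring
  rw [h1, h2]
  nlinarith [sq_nonneg (norm2 (v - W.transpose.mulVec (W.mulVec v)))]

/-! ### A finite grid replacing a net of the sphere. -/

/-- The points with one coordinate `1` and the other ones in a grid of `[-1, 1]`. -/
def gridPoint {k N : ℕ} (p : Fin (k + 1) × (Fin k → Fin (2 * N + 1))) : Fin (k + 1) → ℝ :=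
  p.1.insertNth (α := fun _ => ℝ) 1 (fun i => ((p.2 i : ℕ) - (N : ℝ)) / N)

theorem gridPoint_apply_self {k N : ℕ} (p : Fin (k + 1) × (Fin k → Fin (2 * N + 1))) :
    gridPoint p p.1 = 1 := by
  simp [gridPoint]

theorem one_le_norm2_gridPoint {k N : ℕ} (p : Fin (k + 1) × (Fin k → Fin (2 * N + 1))) :
    1 ≤ norm2 (gridPoint p) := by
  have := abs_apply_le_norm2 (gridPoint p) p.1
  rwa [gridPoint_apply_self, abs_one] at this

theorem exists_gridPoint_near {k N : ℕ} (hN : 0 < N) (z : Fin (k + 1) → ℝ) (hz : ∀ i, |z i| ≤ 1)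
    (j : Fin (k + 1)) (hj : z j = 1) :
    ∃ f : Fin k → Fin (2 * N + 1), norm2 (gridPoint (j, f) - z) ≤ √(k + 1) / N := by
  have hN' : (0 : ℝ) < N := by exact_mod_cast hN
  have key : ∀ i, ∃ c : Fin (2 * N + 1),
      |((c : ℕ) - (N : ℝ)) / N - z (j.succAbove i)| ≤ 1 / N := by
    intro i
    obtain ⟨h1, h2⟩ := abs_le.1 (hz (j.succAbove i))
    set x := z (j.succAbove i)
    have hpos : 0 ≤ N * x + N := by nlinarith
    have hle : N * x + N ≤ (2 * N : ℕ) := by push_cast; nlinarith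
    have hfl : ⌊N * x + N⌋₊ < 2 * N + 1 :=
      Nat.lt_succ_of_le (Nat.cast_le.1 ((Nat.floor_le hpos).trans hle) )
    refine ⟨⟨⌊N * x + N⌋₊, hfl⟩, ?_⟩
    have e : ((⌊N * x + N⌋₊ : ℝ) - N) / N - x = ((⌊N * x + N⌋₊ : ℝ) - (N * x + N)) / N := by
      field_simp; ring
    simp only [e]
    rw [abs_div, abs_of_pos hN']
    gcongr
    rw [abs_le]
    constructor
    · linarith [Nat.lt_floor_add_one (N * x + N)]
    · linarith [Nat.floor_le hpos]
  choose f hf using key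
  refine ⟨f, norm2_le_of_sq_le (by positivity) ?_⟩
  have : ∀ i, (gridPoint (j, f) - z) i ^ 2 ≤ (1 / N) ^ 2 := by
    intro i
    rw [sq_le_sq, abs_of_nonneg (by positivity : (0 : ℝ) ≤ 1 / N)]
    induction i using j.succAboveCases with
    | x => simp [gridPoint, hj]
    | p i => simpa [gridPoint] using hf i
  refine (Finset.sum_le_sum fun i _ => this i).trans (le_of_eq ?_)
  rw [div_pow √(_ : ℝ), Real.sq_sqrt (by positivity)]
  simp
  field_simp

/-- By homogeneity `z` may be divided by its largest coordinate, which puts it in the cube with one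
coordinate equal to `1`. Moving to a nearby grid point costs at most `τ`; as grid points have norm
at least `1`, this only doubles `τ`. -/
theorem exists_gridPoint_of_lt {l k N : ℕ} (hN : 0 < N) (M : Matrix (Fin l) (Fin (k + 1)) ℝ)
    {R τ : ℝ} (hR : ∀ v, norm2 (M.mulVec v) ≤ R * norm2 v) (hR0 : 0 ≤ R) (hτ : 0 ≤ τ)
    (h : (τ + R) * (√(k + 1) / N) ≤ τ) {z : Fin (k + 1) → ℝ}
    (hz : norm2 (M.mulVec z) < τ * norm2 z) :
    ∃ p : Fin (k + 1) × (Fin k → Fin (2 * N + 1)),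
      norm2 (M.mulVec (gridPoint p)) ≤ 2 * τ * norm2 (gridPoint p) := by
  obtain ⟨j, -, hj⟩ := Finset.exists_max_image Finset.univ (fun i => |z i|) Finset.univ_nonempty
  have hzj : z j ≠ 0 := by
    intro h0
    have : z = 0 := by
      ext i
      have := hj i (Finset.mem_univ i)
      rw [h0, abs_zero] at this
      simpa using abs_nonpos_iff.1 this
    simp [this, norm2] at hz
  set y := (z j)⁻¹ • z with hy
  have hyz : norm2 (M.mulVec y) ≤ τ * norm2 y := by
    rw [hy, Matrix.mulVec_smul, norm2_smul, norm2_smul]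
    nlinarith [mul_le_mul_of_nonneg_left hz.le (abs_nonneg (z j)⁻¹)]
  obtain ⟨f, hf⟩ := exists_gridPoint_near hN y (fun i => by
    simp only [hy, Pi.smul_apply, smul_eq_mul, abs_mul, abs_inv]
    rw [inv_mul_le_iff₀ (abs_pos.2 hzj), mul_one]
    exact hj i (Finset.mem_univ i)) j (by simp [hy, hzj])
  refine ⟨(j, f), ?_⟩
  set g := gridPoint (j, f)
  have h1 : norm2 (M.mulVec g) ≤ norm2 (M.mulVec y) + norm2 (M.mulVec (g - y)) := by
    refine le_trans (le_of_eq ?_) (norm2_add_le _ _)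
    rw [← Matrix.mulVec_add]; simp
  have h2 : norm2 y ≤ norm2 g + norm2 (g - y) := by
    have := norm2_add_le g (-(g - y))
    rw [norm2_neg] at this
    simpa using this
  have h3 := hR (g - y)
  have h4 : 1 ≤ norm2 g := one_le_norm2_gridPoint _
  calc norm2 (M.mulVec g) ≤ τ * (norm2 g + norm2 (g - y)) + R * norm2 (g - y) := by
        refine h1.trans (add_le_add (hyz.trans ?_) h3); gcongr
    _ = τ * norm2 g + (τ + R) * norm2 (g - y) := by ring
    _ ≤ τ * norm2 g + (τ + R) * (√(k + 1) / N) := by gcongr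
    _ ≤ 2 * τ * norm2 g := by nlinarith

/-! ### Small ball estimates for `W E`. -/

section Probability

variable {Ω : Type*} [MeasurableSpace Ω] {P : Measure Ω} [IsProbabilityMeasure P]

/-- The coordinates of `W E x / ‖x‖` are the combinations of the entries of `E` with coefficients
`W_a ⊗ x/‖x‖`. These are orthonormal, so the squared norm is chi-squared with `l` degrees of
freedom. -/
theorem measureReal_norm2_mulVec_le {l m k : ℕ} {W : Matrix (Fin l) (Fin m) ℝ}
    (hW : W * W.transpose = 1) {E : Ω → Matrix (Fin m) (Fin k) ℝ}
    (hE : ∀ i j, HasLaw (fun ω => E ω i j) (gaussianReal 0 1) P)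
    (hi : iIndepFun (fun (p : Fin m × Fin k) (ω : Ω) => E ω p.1 p.2) P)
    {x : Fin k → ℝ} (hx : x ≠ 0) {s : ℝ} (hs : 0 < s) :
    P.real {ω | norm2 ((W * E ω).mulVec x) ≤ s * √l * norm2 x} ≤ (2 * s) ^ l := by
  have hx0 := norm2_pos hx
  have horth : ∀ a b, ∑ p : Fin m × Fin k, (W a p.1 * (x p.2 / norm2 x)) *
      (W b p.1 * (x p.2 / norm2 x)) = if a = b then 1 else 0 := by
    intro a b
    have h1 : ∑ i, W a i * W b i = if a = b then 1 else 0 := by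
      have := congr_fun₂ hW a b
      simpa [Matrix.mul_apply, Matrix.one_apply] using this
    have h2 : ∑ j, (x j / norm2 x) * (x j / norm2 x) = 1 := by
      have : ∀ j, (x j / norm2 x) * (x j / norm2 x) = x j ^ 2 / norm2 x ^ 2 := fun j => by ring
      simp_rw [this]
      rw [← Finset.sum_div, ← norm2_sq, div_self (by positivity)]
    rw [← h1, Fintype.sum_prod_type]
    refine Eq.trans ?_ (mul_one _)
    rw [← h2, Finset.sum_mul_sum]
    exact Finset.sum_congr rfl fun i _ => Finset.sum_congr rfl fun j _ => by ring
  obtain ⟨hX, hXi⟩ := gaussian_of_orthonormal (g := fun (p : Fin m × Fin k) ω => E ω p.1 p.2)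
    (fun p => hE p.1 p.2) hi horth
  have := measureReal_sum_sq_le hX hXi hs
  rw [Fintype.card_fin] at this
  refine (measureReal_mono ?_).trans this
  intro ω hω
  simp only [Set.mem_ofPred_eq] at hω ⊢
  have e : ∀ a, (∑ p : Fin m × Fin k, W a p.1 * (x p.2 / norm2 x) * E ω p.1 p.2) =
      ((W * E ω).mulVec x) a / norm2 x := by
    intro a
    rw [← Matrix.mulVec_mulVec, Fintype.sum_prod_type]
    simp only [Matrix.mulVec, dotProduct, Finset.mul_sum, Finset.sum_div]
    exact Finset.sum_congr rfl fun i _ => Finset.sum_congr rfl fun j _ => by ring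
  simp_rw [e, div_pow]
  rw [← Finset.sum_div, ← norm2_sq, div_le_iff₀ (by positivity)]
  calc _ ≤ (s * √l * norm2 x) ^ 2 := by gcongr; exact norm2_nonneg _
    _ = _ := by rw [mul_pow, mul_pow, Real.sq_sqrt (by positivity)]

/-- Small ball estimate for the smallest singular value of `W E`, where the rows of `W` are
orthonormal and `E` is a Gaussian matrix. -/
theorem measureReal_exists_norm2_mulVec_lt {l m k N : ℕ} (hN : 0 < N)
    {W : Matrix (Fin l) (Fin m) ℝ}
    (hW : W * W.transpose = 1) {E : Ω → Matrix (Fin m) (Fin (k + 1)) ℝ}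
    (hE : ∀ i j, HasLaw (fun ω => E ω i j) (gaussianReal 0 1) P)
    (hi : iIndepFun (fun (p : Fin m × Fin (k + 1)) (ω : Ω) => E ω p.1 p.2) P)
    {s : ℝ} (hs : 0 < s)
    (h : (s * √l + √(8 * (m * (k + 1)))) * (√(k + 1) / N) ≤ s * √l) :
    P.real {ω | ∃ z, norm2 ((W * E ω).mulVec z) < s * √l * norm2 z} ≤
      Real.exp (-(m * (k + 1))) + (k + 1) * (2 * N + 1) ^ k * (4 * s) ^ l := by
  have hcard : (Fintype.card (Fin m × Fin (k + 1)) : ℝ) = m * (k + 1) := by simp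
  have hb := measureReal_le_sum_sq (fun p : Fin m × Fin (k + 1) => hE p.1 p.2) hi
  rw [hcard] at hb
  have hg : ∀ p : Fin (k + 1) × (Fin k → Fin (2 * N + 1)),
      P.real {ω | norm2 ((W * E ω).mulVec (gridPoint p)) ≤ 2 * s * √l * norm2 (gridPoint p)} ≤
        (4 * s) ^ l := by
    intro p
    have hp : gridPoint p ≠ 0 := by
      intro h0
      simpa [h0] using gridPoint_apply_self p
    have := measureReal_norm2_mulVec_le hW hE hi hp (s := 2 * s) (by positivity)
    rwa [← mul_assoc, show (2 : ℝ) * 2 = 4 by norm_num] at this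
  -- Either the Frobenius norm of `E`, which controls the discretization error, is large, or the
  -- failure is already visible at a grid point.
  have hsub : {ω | ∃ z, norm2 ((W * E ω).mulVec z) < s * √l * norm2 z} ⊆
      {ω | 8 * ((m : ℝ) * (k + 1)) ≤ ∑ p : Fin m × Fin (k + 1), E ω p.1 p.2 ^ 2} ∪
      ⋃ p : Fin (k + 1) × (Fin k → Fin (2 * N + 1)),
        {ω | norm2 ((W * E ω).mulVec (gridPoint p)) ≤ 2 * s * √l * norm2 (gridPoint p)} := by
    rintro ω ⟨z, hz⟩
    by_cases hω : 8 * ((m : ℝ) * (k + 1)) ≤ ∑ p : Fin m × Fin (k + 1), E ω p.1 p.2 ^ 2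
    · exact Or.inl hω
    · right
      push Not at hω
      have hM : ∀ v, norm2 ((W * E ω).mulVec v) ≤ √(8 * (m * (k + 1))) * norm2 v := by
        intro v
        rw [← Matrix.mulVec_mulVec]
        refine (norm2_mulVec_le_of_mul_transpose hW _).trans ?_
        refine abs_le_of_sq_le_sq' ?_ (mul_nonneg (Real.sqrt_nonneg _) (norm2_nonneg v)) |>.2
        refine (norm2_mulVec_sq_le _ _).trans ?_
        rw [mul_pow, Real.sq_sqrt (by positivity)]
        gcongr
      obtain ⟨p, hp⟩ := exists_gridPoint_of_lt hN _ hM (by positivity) (by positivity) h hz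
      exact Set.mem_iUnion.2 ⟨p, by simpa [mul_assoc] using hp⟩
  refine (measureReal_mono hsub).trans ((measureReal_union_le _ _).trans (add_le_add hb ?_))
  refine (measureReal_iUnion_fintype_le _).trans ((Finset.sum_le_sum fun p _ => hg p).trans ?_)
  simp

end Probability

/-! ### Smallest singular value, pseudoinverse and Sobolev duals. -/

theorem le_sigmaMin {m k : ℕ} (hk : 1 ≤ k) {A : Matrix (Fin m) (Fin k) ℝ} {τ : ℝ} (hτ : 0 ≤ τ)
    (h : ∀ z, τ * norm2 z ≤ norm2 (A.mulVec z)) : τ ≤ sigmaMin A := by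
  set T := Matrix.toEuclideanLin A
  have hlt : k - 1 < Module.finrank ℝ (EuclideanSpace ℝ (Fin k)) := by
    rw [finrank_euclideanSpace_fin]; omega
  -- An eigenvector of `AᵀA` for the eigenvalue `σ_min²` attains the infimum.
  obtain ⟨v, hv⟩ := (T.hasEigenvalue_adjoint_comp_self_sq_singularValues hlt).exists_hasEigenvector
  have hv0 := hv.2
  have h1 : ‖T v‖ ^ 2 = sigmaMin A ^ 2 * ‖v‖ ^ 2 := by
    have e := hv.apply_eq_smul
    rw [← real_inner_self_eq_norm_sq, ← LinearMap.adjoint_inner_left]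
    change inner ℝ ((T.adjoint ∘ₗ T) v) v = _
    rw [e, real_inner_smul_left, real_inner_self_eq_norm_sq]
    rfl
  have h2 : τ * ‖v‖ ≤ ‖T v‖ := h v.ofLp
  have hpos : 0 < ‖v‖ := norm_pos_iff.2 hv0
  have h3 : (τ * ‖v‖) ^ 2 ≤ (sigmaMin A * ‖v‖) ^ 2 := by
    rw [mul_pow (sigmaMin A), ← h1]; gcongr
  have h4 : 0 ≤ sigmaMin A := T.singularValues_nonneg _
  have := abs_le_of_sq_le_sq' h3 (by positivity) |>.2
  exact le_of_mul_le_mul_right this hpos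

theorem sigmaMin_mul_norm2_le {m k : ℕ} (hk : 1 ≤ k) (A : Matrix (Fin m) (Fin k) ℝ)
    (z : Fin k → ℝ) : sigmaMin A * norm2 z ≤ norm2 (A.mulVec z) := by
  set T := Matrix.toEuclideanLin A
  set v : EuclideanSpace ℝ (Fin k) := WithLp.toLp 2 z
  have hn : Module.finrank ℝ (EuclideanSpace ℝ (Fin k)) = k := finrank_euclideanSpace_fin
  have hT := T.isSymmetric_adjoint_comp_self
  have hs : ∀ i : Fin k, sigmaMin A ^ 2 ≤ hT.eigenvalues hn i := by
    intro i
    rw [← T.sq_singularValues_fin hn i]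
    refine pow_le_pow_left₀ (T.singularValues_nonneg _) ?_ 2
    exact T.singularValues_antitone (by omega)
  have h1 : ‖T v‖ ^ 2 = ∑ i, hT.eigenvalues hn i * (hT.eigenvectorBasis hn).repr v i ^ 2 := by
    rw [← real_inner_self_eq_norm_sq, ← LinearMap.adjoint_inner_left]
    change inner ℝ ((T.adjoint ∘ₗ T) v) v = _
    rw [← (hT.eigenvectorBasis hn).repr.inner_map_map, PiLp.inner_apply]
    refine Finset.sum_congr rfl fun i _ => ?_
    rw [hT.eigenvectorBasis_apply_self_apply hn v i]
    simp
    ring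
  have h2 : ‖v‖ ^ 2 = ∑ i, (hT.eigenvectorBasis hn).repr v i ^ 2 := by
    rw [← (hT.eigenvectorBasis hn).repr.norm_map v, EuclideanSpace.norm_sq_eq]
    simp
  refine abs_le_of_sq_le_sq' (b := ‖T v‖) (a := sigmaMin A * ‖v‖) ?_ (norm_nonneg _) |>.2
  rw [mul_pow, h1, h2, Finset.mul_sum]
  exact Finset.sum_le_sum fun i _ => mul_le_mul_of_nonneg_right (hs i) (sq_nonneg _)

theorem norm2_mulVec_le_opNorm {m n : ℕ} (A : Matrix (Fin m) (Fin n) ℝ) (x : Fin n → ℝ) :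
    norm2 (A.mulVec x) ≤ opNorm A * norm2 x :=
  Matrix.l2_opNorm_mulVec A (WithLp.toLp 2 x)

theorem opNorm_nonneg {m n : ℕ} (A : Matrix (Fin m) (Fin n) ℝ) : 0 ≤ opNorm A := by
  open scoped Matrix.Norms.L2Operator in exact norm_nonneg A

theorem opNorm_le {m n : ℕ} {A : Matrix (Fin m) (Fin n) ℝ} {c : ℝ} (hc : 0 ≤ c)
    (h : ∀ x, norm2 (A.mulVec x) ≤ c * norm2 x) : opNorm A ≤ c :=
  ContinuousLinearMap.opNorm_le_bound _ hc fun x => h x.ofLp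

section Pinv

variable {m k : ℕ} {A : Matrix (Fin m) (Fin k) ℝ}

theorem isUnit_det_transpose_mul_self {τ : ℝ} (hτ : 0 < τ)
    (h : ∀ z, τ * norm2 z ≤ norm2 (A.mulVec z)) : IsUnit (A.transpose * A).det := by
  rw [← Matrix.isUnit_iff_isUnit_det, ← Matrix.mulVec_injective_iff_isUnit]
  rw [← Matrix.coe_mulVecLin, ← LinearMap.ker_eq_bot, LinearMap.ker_eq_bot']
  intro z hz
  rw [Matrix.mulVecLin_apply] at hz
  have h1 : A.mulVec z ⬝ᵥ A.mulVec z = 0 := by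
    have : z ⬝ᵥ (A.transpose * A).mulVec z = 0 := by rw [hz, dotProduct_zero]
    rwa [← Matrix.mulVec_mulVec, Matrix.dotProduct_mulVec, Matrix.vecMul_transpose] at this
  have h2 : norm2 (A.mulVec z) = 0 := by
    rw [dotProduct_self_eq_zero] at h1
    simp [h1, norm2]
  have h3 := h z
  rw [h2] at h3
  by_contra hne
  nlinarith [norm2_pos hne]

theorem pinv_mul_self (hA : IsUnit (A.transpose * A).det) : pinv A * A = 1 := by
  rw [pinv, Matrix.mul_assoc, Matrix.nonsing_inv_mul _ hA]

/-- `A A^†` is a contraction. -/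
theorem norm2_mul_pinv_mulVec_le (hA : IsUnit (A.transpose * A).det) (y : Fin m → ℝ) :
    norm2 ((A * pinv A).mulVec y) ≤ norm2 y := by
  set p := (A * pinv A).mulVec y
  -- Hence `y - p` is orthogonal to the range of `A`, and Pythagoras applies.
  have h2 : A.transpose * (A * pinv A) = A.transpose := by
    rw [pinv, ← Matrix.mul_assoc, ← Matrix.mul_assoc, Matrix.mul_nonsing_inv _ hA, Matrix.one_mul]
  have h3 : p ⬝ᵥ p = p ⬝ᵥ y := by
    have e : p = A.mulVec ((pinv A).mulVec y) := by simp [p]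
    have e2 : ∀ w, p ⬝ᵥ w = (pinv A).mulVec y ⬝ᵥ A.transpose.mulVec w := fun w => by
      rw [e, ← Matrix.vecMul_transpose, ← Matrix.dotProduct_mulVec]
    rw [e2, e2, Matrix.mulVec_mulVec, h2]
  have h4 : norm2 p ^ 2 = p ⬝ᵥ p := by rw [norm2_sq]; simp [dotProduct, sq]
  have h5 : norm2 y ^ 2 = y ⬝ᵥ y := by rw [norm2_sq]; simp [dotProduct, sq]
  have h6 : norm2 (y - p) ^ 2 = norm2 y ^ 2 - norm2 p ^ 2 := by
    have : norm2 (y - p) ^ 2 = (y - p) ⬝ᵥ (y - p) := by rw [norm2_sq]; simp [dotProduct, sq]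
    rw [this, h4, h5, sub_dotProduct, dotProduct_sub, dotProduct_sub, dotProduct_comm y p, h3]
    ring
  refine abs_le_of_sq_le_sq' ?_ (norm2_nonneg y) |>.2
  nlinarith [sq_nonneg (norm2 (y - p))]

/-- The Moore-Penrose inverse has minimal operator norm among the left inverses. -/
theorem opNorm_pinv_le (hA : IsUnit (A.transpose * A).det) {H : Matrix (Fin k) (Fin m) ℝ}
    (hH : H * A = 1) : opNorm (pinv A) ≤ opNorm H := by
  refine opNorm_le (opNorm_nonneg H) fun y => ?_
  have e : pinv A = H * (A * pinv A) := by rw [← Matrix.mul_assoc, hH, Matrix.one_mul]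
  conv_lhs => rw [e, ← Matrix.mulVec_mulVec]
  refine (norm2_mulVec_le_opNorm _ _).trans ?_
  exact mul_le_mul_of_nonneg_left (norm2_mul_pinv_mulVec_le hA y) (opNorm_nonneg H)

theorem opNorm_pinv_le_inv {τ : ℝ} (hτ : 0 < τ)
    (h : ∀ z, τ * norm2 z ≤ norm2 (A.mulVec z)) : opNorm (pinv A) ≤ τ⁻¹ := by
  have hA := isUnit_det_transpose_mul_self hτ h
  refine opNorm_le (by positivity) fun y => ?_
  rw [le_inv_mul_iff₀ hτ]
  refine (h _).trans ?_
  rw [Matrix.mulVec_mulVec]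
  exact norm2_mul_pinv_mulVec_le hA y

end Pinv

theorem isUnit_det_D (m : ℕ) : IsUnit (D m).det := by
  have : (D m).det = 1 := by
    rw [Matrix.det_of_isLowerTriangular]
    · simp [D]
    · intro i j hij
      have : i < j := hij
      have h2 : (i : ℕ) < j := this
      simp only [D, Matrix.of_apply]
      rw [if_neg this.ne, if_neg (by omega)]
  simp [this]

theorem isUnit_det_D_pow (m r : ℕ) : IsUnit (D m ^ r).det := by
  rw [Matrix.det_pow]; exact (isUnit_det_D m).pow r

/-- The substitution `H = G D^r` turns left inverses of `E` into left inverses of `D^{-r}E`, among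
which the pseudoinverse has least norm. -/
theorem isSobolevDual_sobolevDual {m k : ℕ} (r : ℕ) {E : Matrix (Fin m) (Fin k) ℝ}
    (hA : IsUnit (((D m ^ r)⁻¹ * E).transpose * ((D m ^ r)⁻¹ * E)).det) :
    IsSobolevDual r E (sobolevDual r E) := by
  have hD := isUnit_det_D_pow m r
  refine ⟨by rw [sobolevDual, Matrix.mul_assoc, pinv_mul_self hA], fun G hG => ?_⟩
  rw [sobolevDual, Matrix.mul_assoc, Matrix.nonsing_inv_mul _ hD, Matrix.mul_one]
  refine opNorm_pinv_le hA ?_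
  rw [Matrix.mul_assoc, Matrix.mul_nonsing_inv_cancel_left _ _ hD, hG]

/-! ### Differences as polynomials in the shift, and stability of the greedy quantizer. -/

/-- The `m × m` shift matrix, with ones on the first subdiagonal. -/
def shift (m : ℕ) : Matrix (Fin m) (Fin m) ℝ :=
  Matrix.of fun i j => if (i : ℕ) = (j : ℕ) + 1 then 1 else 0

theorem D_eq_one_sub_shift (m : ℕ) : D m = 1 - shift m := by
  ext i j
  simp only [D, shift, Matrix.of_apply, Matrix.sub_apply, Matrix.one_apply]
  by_cases h : i = j
  · subst h; simp
  · simp [h, neg_ite]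

theorem shift_pow_apply (m n : ℕ) (i j : Fin m) :
    (shift m ^ n) i j = if (i : ℕ) = (j : ℕ) + n then 1 else 0 := by
  induction n generalizing i j with
  | zero => simp [Matrix.one_apply, Fin.ext_iff]
  | succ n ih =>
    rw [pow_succ, Matrix.mul_apply]
    simp_rw [ih]
    simp only [shift, Matrix.of_apply, mul_ite, mul_one, mul_zero]
    by_cases h : (i : ℕ) = j + (n + 1)
    · rw [if_pos h, Finset.sum_eq_single ⟨j + 1, by omega⟩]
      · simp; omega
      · intro b _ hb
        rw [if_neg]
        intro hb2
        exact hb (Fin.ext hb2)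
      · simp
    · rw [if_neg h]
      refine Finset.sum_eq_zero fun x _ => ?_
      split_ifs <;> first | rfl | omega

theorem shift_pow_mulVec {m : ℕ} (u : Fin m → ℝ) (j : Fin m) (i : ℕ) :
    (shift m ^ i).mulVec u j = past u j i := by
  simp only [Matrix.mulVec, dotProduct, shift_pow_apply, past, ite_mul, one_mul, zero_mul]
  split_ifs with h
  · rw [Finset.sum_eq_single ⟨j - i, lt_of_le_of_lt (Nat.sub_le _ _) j.isLt⟩]
    · simp; omega
    · intro b _ hb
      rw [if_neg]
      intro hb2
      exact hb (Fin.ext (by simp; omega))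
    · simp
  · exact Finset.sum_eq_zero fun x _ => if_neg (by omega)

theorem D_pow_mulVec {m : ℕ} (r : ℕ) (u : Fin m → ℝ) : (D m ^ r).mulVec u = diffPow r u := by
  ext j
  have : D m ^ r = ∑ i ∈ Finset.range (r + 1), ((-1 : ℝ) ^ i * (r.choose i : ℝ)) • shift m ^ i := by
    rw [D_eq_one_sub_shift, sub_eq_neg_add, ← neg_one_smul ℝ (shift m),
      (Commute.one_right _).add_pow]
    refine Finset.sum_congr rfl fun i _ => ?_
    rw [one_pow, mul_one, smul_pow, ← nsmul_eq_mul', ← Nat.cast_smul_eq_nsmul ℝ, smul_smul,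
      mul_comm]
  rw [this, Matrix.sum_mulVec]
  simp [diffPow, Matrix.smul_mulVec, shift_pow_mulVec]

theorem IsGreedyOutput.abs_state_le {r : ℕ} {δ : ℝ} (hδ : 0 < δ) {m : ℕ} {y q u : Fin m → ℝ}
    (h : IsGreedyOutput r δ y q u) (j : Fin m) : |u j| ≤ δ / 2 := by
  -- Isolating the term `i = 0` of the difference shows that the state is exactly the rounding
  -- error.
  have h1 : u j = greedyInput r y u j - q j := by
    have h2 := h.state_eq j
    rw [diffPow, Finset.sum_range_eq_add_Ico _ (by omega)] at h2
    have h3 : ∑ i ∈ Finset.Ico 1 (r + 1), (-1 : ℝ) ^ i * (r.choose i : ℝ) * past u j i =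
        -∑ i ∈ Finset.Icc 1 r, (-1 : ℝ) ^ (i - 1) * (r.choose i : ℝ) * past u j i := by
      rw [← Finset.sum_neg_distrib]
      refine Finset.sum_congr (by ext; simp) fun i hi => ?_
      obtain ⟨n, rfl⟩ : ∃ n, i = n + 1 := ⟨i - 1, by simp at hi; omega⟩
      rw [Nat.add_sub_cancel, pow_succ]; ring
    rw [h3] at h2
    simp only [past, zero_le, if_true, pow_zero, Nat.choose_zero_right, Nat.cast_one, one_mul,
      Nat.sub_zero, Fin.eta] at h2
    rw [greedyInput]
    simp only [past] at *
    linarith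
  set g := greedyInput r y u j
  have h2 := h.greedy j (round (g / δ))
  rw [← h1] at h2
  refine h2.trans ?_
  have h3 := abs_sub_round (g / δ)
  have h4 : g - δ * round (g / δ) = δ * (g / δ - round (g / δ)) := by field_simp
  rw [h4, abs_mul, abs_of_pos hδ]
  nlinarith

theorem norm2_le_of_abs_le {m : ℕ} {u : Fin m → ℝ} {c : ℝ} (hc : 0 ≤ c) (h : ∀ j, |u j| ≤ c) :
    norm2 u ≤ c * √m := by
  refine norm2_le_of_sq_le (by positivity) ?_
  rw [mul_pow, Real.sq_sqrt (by positivity)]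
  refine (Finset.sum_le_sum fun j _ => sq_le_sq' (abs_le.1 (h j)).1 (abs_le.1 (h j)).2).trans ?_
  simp [mul_comm]

/-- Existence of Sobolev duals and the reconstruction error, given a lower bound `τ` for the
smallest singular value of `D^{-r} E`. -/
theorem sobolevDual_reconstruction {r m k : ℕ} (hk : 1 ≤ k) {E : Matrix (Fin m) (Fin k) ℝ} {τ : ℝ}
    (hτ : 0 < τ) (h : τ ≤ sigmaMin ((D m ^ r)⁻¹ * E)) :
    IsSobolevDual r E (sobolevDual r E) ∧
      ∀ F : Matrix (Fin k) (Fin m) ℝ, IsSobolevDual r E F →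
      ∀ (δ : ℝ), 0 < δ → ∀ (x : Fin k → ℝ) (q u : Fin m → ℝ),
        IsGreedyOutput r δ (E.mulVec x) q u →
        norm2 (x - F.mulVec q) ≤ τ⁻¹ * (δ / 2 * √m) := by
  have hz : ∀ z, τ * norm2 z ≤ norm2 (((D m ^ r)⁻¹ * E).mulVec z) := fun z =>
    (mul_le_mul_of_nonneg_right h (norm2_nonneg z)).trans (sigmaMin_mul_norm2_le hk _ z)
  have hS := isSobolevDual_sobolevDual r (isUnit_det_transpose_mul_self hτ hz)
  refine ⟨hS, fun F hF δ hδ x q u hu => ?_⟩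
  have hop : opNorm (F * D m ^ r) ≤ τ⁻¹ := by
    -- Minimality transfers the bound from the explicit dual to every Sobolev dual.
    refine (hF.2 _ hS.1).trans ?_
    rw [sobolevDual, Matrix.mul_assoc, Matrix.nonsing_inv_mul _ (isUnit_det_D_pow m r),
      Matrix.mul_one]
    exact opNorm_pinv_le_inv hτ hz
  have e1 : (D m ^ r).mulVec u = E.mulVec x - q := by
    rw [D_pow_mulVec]; ext j; exact hu.state_eq j
  have e2 : x - F.mulVec q = (F * D m ^ r).mulVec u := by
    rw [← Matrix.mulVec_mulVec, e1, Matrix.mulVec_sub, Matrix.mulVec_mulVec, hF.1,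
      Matrix.one_mulVec]
  rw [e2]
  refine (norm2_mulVec_le_opNorm _ _).trans ?_
  exact mul_le_mul hop (norm2_le_of_abs_le (by positivity) (hu.abs_state_le hδ))
    (norm2_nonneg _) (by positivity)

/-! ### Orthonormal smooth bumps on disjoint blocks. -/

section Blocks

open Polynomial

theorem aeval_shift_apply {m : ℕ} (p : ℝ[X]) (i j : Fin m) :
    aeval (shift m) p i j = if (j : ℕ) ≤ i then p.coeff (i - j) else 0 := by
  rw [aeval_eq_sum_range, Matrix.sum_apply]
  simp only [Matrix.smul_apply, shift_pow_apply, smul_eq_mul, mul_ite, mul_one, mul_zero]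
  split_ifs with h
  · by_cases h2 : (i - j : ℕ) < p.natDegree + 1
    · rw [Finset.sum_eq_single_of_mem (i - j : ℕ) (Finset.mem_range.2 h2)]
      · rw [if_pos (by omega)]
      · intro b _ hb
        rw [if_neg (by omega)]
    · rw [coeff_eq_zero_of_natDegree_lt (by omega)]
      refine Finset.sum_eq_zero fun n hn => if_neg ?_
      have := Finset.mem_range.1 hn
      omega
  · exact Finset.sum_eq_zero fun n _ => if_neg (by omega)

/-- The rows `b - 1, 2 b - 1, …, l b - 1` of the matrix `p(shift m)`. -/
def blockRows {l b m : ℕ} (h : l * b ≤ m) (hb : 0 < b) (p : ℝ[X]) : Matrix (Fin l) (Fin m) ℝ :=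
  (aeval (shift m) p).submatrix (fun i => ⟨(i + 1) * b - 1, by
    have := Nat.mul_le_mul_right b (Nat.succ_le_of_lt i.isLt)
    have : 0 < (i + 1 : ℕ) * b := by positivity
    simp only [Nat.succ_eq_add_one] at *
    omega⟩) id

variable {l b m : ℕ} {h : l * b ≤ m} {hb : 0 < b} {p : ℝ[X]}

theorem blockRows_apply (i : Fin l) (a : Fin m) : blockRows h hb p i a =
    if (a : ℕ) ≤ (i + 1) * b - 1 then p.coeff ((i + 1) * b - 1 - a) else 0 := by
  simp [blockRows, aeval_shift_apply]

/-- Row `i` reaches back at most `natDegree p < b` places from the last index `(i+1)b - 1` of its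
block, so it never leaves the block; `a / b` is the block containing `a`. -/
theorem blockRows_eq_zero (hp : p.natDegree < b) {i : Fin l} {a : Fin m} (ha : (a : ℕ) / b ≠ i) :
    blockRows h hb p i a = 0 := by
  rw [blockRows_apply]
  split_ifs with h1
  · refine coeff_eq_zero_of_natDegree_lt (hp.trans_le ?_)
    by_contra hlt
    refine ha (Nat.div_eq_of_lt_le ?_ ?_)
    · rw [add_mul, one_mul] at *; omega
    · have : 0 < (i + 1 : ℕ) * b := by positivity
      omega
  · rfl

theorem sum_blockRows_sq (hp : p.natDegree < b) (i : Fin l) :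
    ∑ a, blockRows h hb p i a ^ 2 = ∑ n ∈ Finset.range b, p.coeff n ^ 2 := by
  have h1 : (i + 1 : ℕ) * b ≤ m := (Nat.mul_le_mul_right b (Nat.succ_le_of_lt i.isLt)).trans h
  have h2 : b ≤ (i + 1 : ℕ) * b := Nat.le_mul_of_pos_left b (by omega)
  set c := (i + 1 : ℕ) * b
  simp_rw [blockRows_apply]
  rw [Fin.sum_univ_eq_sum_range
    (fun a => (if a ≤ c - 1 then p.coeff (c - 1 - a) else 0) ^ 2) m]
  rw [← Finset.sum_subset (Finset.range_mono h1)]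
  · have e : ∀ a ∈ Finset.range c, (if a ≤ c - 1 then p.coeff (c - 1 - a) else 0) ^ 2 =
        p.coeff (c - 1 - a) ^ 2 := by
      intro a ha
      rw [if_pos]
      have := Finset.mem_range.1 ha
      omega
    rw [Finset.sum_congr rfl e, Finset.sum_range_reflect (fun n => p.coeff n ^ 2) c]
    symm
    refine Finset.sum_subset (Finset.range_mono h2) fun n _ hn => ?_
    rw [coeff_eq_zero_of_natDegree_lt (by simp at hn; omega)]
    simp
  · intro a _ ha
    rw [if_neg (by simp at ha; omega)]
    simp

theorem blockRows_mul_transpose (hp : p.natDegree < b) :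
    blockRows h hb p * (blockRows h hb p).transpose =
      (∑ n ∈ Finset.range b, p.coeff n ^ 2) • (1 : Matrix (Fin l) (Fin l) ℝ) := by
  ext i j
  rw [Matrix.mul_apply, Matrix.smul_apply, Matrix.one_apply]
  split_ifs with hij
  · subst hij
    rw [← sum_blockRows_sq (h := h) (hb := hb) hp i]
    simp [sq]
  · rw [smul_zero]
    refine Finset.sum_eq_zero fun a _ => ?_
    by_cases ha : (a : ℕ) / b = i
    · rw [Matrix.transpose_apply, blockRows_eq_zero (i := j) hp, mul_zero]
      rw [ha]
      exact fun hc => hij (Fin.ext hc)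
    · rw [blockRows_eq_zero hp ha, zero_mul]

/-- Cauchy–Schwarz is applied block by block; since the blocks are disjoint, the bound is that of a
single row, with no factor `l`. -/
theorem norm2_blockRows_mulVec_sq_le (hp : p.natDegree < b) (y : Fin m → ℝ) :
    norm2 ((blockRows h hb p).mulVec y) ^ 2 ≤
      (∑ n ∈ Finset.range b, p.coeff n ^ 2) * norm2 y ^ 2 := by
  have h1 : ∀ i, (blockRows h hb p).mulVec y i ^ 2 ≤ (∑ n ∈ Finset.range b, p.coeff n ^ 2) *
      ∑ a : Fin m, if (a : ℕ) / b = i then y a ^ 2 else 0 := by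
    intro i
    have e : (blockRows h hb p).mulVec y i =
        ∑ a, blockRows h hb p i a * if (a : ℕ) / b = i then y a else 0 := by
      rw [Matrix.mulVec, dotProduct]
      refine Finset.sum_congr rfl fun a _ => ?_
      split_ifs with ha
      · rfl
      · rw [blockRows_eq_zero hp ha, zero_mul, zero_mul]
    rw [e, ← sum_blockRows_sq (h := h) (hb := hb) hp i]
    refine (Finset.sum_mul_sq_le_sq_mul_sq Finset.univ (blockRows h hb p i)
      (fun a => if (a : ℕ) / b = i then y a else 0)).trans (le_of_eq ?_)
    simp [ite_pow]
  rw [norm2_sq, norm2_sq]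
  refine (Finset.sum_le_sum fun i _ => h1 i).trans ?_
  rw [← Finset.mul_sum, Finset.sum_comm]
  refine mul_le_mul_of_nonneg_left (Finset.sum_le_sum fun a _ => ?_)
    (Finset.sum_nonneg fun _ _ => sq_nonneg _)
  by_cases ha : (a : ℕ) / b < l
  · rw [Finset.sum_eq_single ⟨(a : ℕ) / b, ha⟩]
    · simp
    · intro i _ hi
      rw [if_neg fun hc => hi (Fin.ext hc.symm)]
    · simp
  · rw [Finset.sum_eq_zero]
    · positivity
    · exact fun i _ => if_neg (by omega)

/-- The polynomial `1 + X + ⋯ + X ^ (s - 1)`. -/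
def boxPoly (s : ℕ) : ℝ[X] := ∑ i ∈ Finset.range s, X ^ i

theorem boxPoly_mul (s : ℕ) : boxPoly s * (1 - X) = 1 - X ^ s := geom_sum_mul_neg _ _

theorem coeff_boxPoly (s n : ℕ) : (boxPoly s).coeff n = if n < s then 1 else 0 := by
  simp [boxPoly, coeff_X_pow]

theorem natDegree_boxPoly_le (s : ℕ) : (boxPoly s).natDegree ≤ s - 1 := by
  rw [natDegree_le_iff_coeff_eq_zero]
  intro n hn
  rw [coeff_boxPoly, if_neg (by omega)]

theorem natDegree_boxPoly_pow_lt {s : ℕ} (hs : 0 < s) (r : ℕ) :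
    (boxPoly s ^ (r + 1)).natDegree < (r + 1) * s := by
  refine (natDegree_pow_le_of_le (r + 1) (natDegree_boxPoly_le s)).trans_lt ?_
  exact Nat.mul_lt_mul_of_pos_left (by omega) (by omega)

theorem natDegree_one_sub_X_pow_mul_boxPoly_lt {s : ℕ} (hs : 0 < s) (r : ℕ) :
    ((1 - X ^ s) ^ r * boxPoly s : ℝ[X]).natDegree < (r + 1) * s := by
  have h1 : (1 - X ^ s : ℝ[X]).natDegree ≤ s :=
    (natDegree_sub_le _ _).trans (by simp)
  have h2 := natDegree_mul_le_of_le (natDegree_pow_le_of_le r h1) (natDegree_boxPoly_le s)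
  refine h2.trans_lt ?_
  rw [add_mul, one_mul]
  omega

theorem abs_coeff_one_sub_X_pow_mul_boxPoly_le (s r n : ℕ) :
    |((1 - X ^ s) ^ r * boxPoly s : ℝ[X]).coeff n| ≤ 2 ^ r := by
  induction r generalizing n with
  | zero =>
    rw [pow_zero, one_mul, coeff_boxPoly]
    split_ifs <;> simp
  | succ r ih =>
    have e : ((1 - X ^ s) ^ (r + 1) * boxPoly s : ℝ[X]) =
        (1 - X ^ s) ^ r * boxPoly s - (1 - X ^ s) ^ r * boxPoly s * X ^ s := by ring
    rw [e, coeff_sub, coeff_mul_X_pow', pow_succ, mul_two]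
    refine (abs_sub _ _).trans (add_le_add (ih n) ?_)
    split_ifs
    · exact ih _
    · simp

/-- The coefficients sum to the value at `1`, which is `s^{r+1}`; Cauchy–Schwarz then bounds their
energy below. -/
theorem le_sum_coeff_boxPoly_pow_sq {s : ℕ} (hs : 0 < s) (r : ℕ) :
    ((s : ℝ) ^ (r + 1)) ^ 2 ≤ ((r + 1) * s : ℕ) *
      ∑ n ∈ Finset.range ((r + 1) * s), (boxPoly s ^ (r + 1)).coeff n ^ 2 := by
  have e : (s : ℝ) ^ (r + 1) =
      ∑ n ∈ Finset.range ((r + 1) * s), (boxPoly s ^ (r + 1)).coeff n := by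
    have h1 : (boxPoly s ^ (r + 1)).eval 1 = (s : ℝ) ^ (r + 1) := by
      simp [boxPoly, eval_finsetSum]
    rw [← h1, eval_eq_sum_range' (natDegree_boxPoly_pow_lt hs r)]
    simp
  rw [e]
  simpa using sq_sum_le_card_mul_sum_sq (s := Finset.range ((r + 1) * s))
    (f := fun n => (boxPoly s ^ (r + 1)).coeff n)

/-- There are `l` orthonormal vectors, supported on disjoint blocks of length `(r + 1) s`, which
are smooth in the sense that testing an `r`-th difference against them gains a factor `s ^ r`. -/
theorem exists_orthonormal_smooth_rows (r : ℕ) {s l m : ℕ} (hs : 0 < s)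
    (h : l * ((r + 1) * s) ≤ m) :
    ∃ W : Matrix (Fin l) (Fin m) ℝ, W * W.transpose = 1 ∧
      ∀ y, norm2 (W.mulVec ((D m ^ r).mulVec y)) ≤ (r + 1) * 2 ^ r / s ^ r * norm2 y := by
  have hb : 0 < (r + 1) * s := by positivity
  set p : ℝ[X] := boxPoly s ^ (r + 1)
  set q : ℝ[X] := (1 - X ^ s) ^ r * boxPoly s
  set V := ∑ n ∈ Finset.range ((r + 1) * s), p.coeff n ^ 2
  have hV := le_sum_coeff_boxPoly_pow_sq hs r
  have hs' : (0 : ℝ) < s := by exact_mod_cast hs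
  have hb' : (0 : ℝ) < ((r + 1) * s : ℕ) := by exact_mod_cast hb
  have hV0 : 0 < V := by
    by_contra hc
    have : 0 < ((s : ℝ) ^ (r + 1)) ^ 2 := by positivity
    nlinarith
  have hp : p.natDegree < (r + 1) * s := natDegree_boxPoly_pow_lt hs r
  have hq : q.natDegree < (r + 1) * s := natDegree_one_sub_X_pow_mul_boxPoly_lt hs r
  -- Each factor `1 - X` telescopes against one box. The spare box matters: with `boxPoly s ^ r` the
  -- gain would only be of order `s^{r-1/2}`.
  have hpq : p * (1 - X) ^ r = q := by
    simp only [p, q]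
    rw [pow_succ, mul_right_comm, ← mul_pow, boxPoly_mul]
  have hD : blockRows h hb p * D m ^ r = blockRows h hb q := by
    have e : aeval (shift m) p * D m ^ r = aeval (shift m) q := by
      rw [← hpq]; simp [D_eq_one_sub_shift]
    rw [blockRows, blockRows, ← e]
    ext i j
    simp [Matrix.mul_apply]
  refine ⟨(√V)⁻¹ • blockRows h hb p, ?_, fun y => ?_⟩
  · rw [Matrix.transpose_smul, Matrix.smul_mul, Matrix.mul_smul, smul_smul,
      blockRows_mul_transpose hp, smul_smul, ← mul_inv, Real.mul_self_sqrt hV0.le,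
      inv_mul_cancel₀ hV0.ne', one_smul]
  · rw [Matrix.mulVec_mulVec, Matrix.smul_mul, hD, Matrix.smul_mulVec, norm2_smul]
    refine abs_le_of_sq_le_sq' ?_ (mul_nonneg (by positivity) (norm2_nonneg y)) |>.2
    rw [mul_pow, mul_pow, sq_abs, inv_pow, Real.sq_sqrt hV0.le]
    have h1 := norm2_blockRows_mulVec_sq_le (h := h) (hb := hb) hq y
    have h2 : ∑ n ∈ Finset.range ((r + 1) * s), q.coeff n ^ 2 ≤ ((r + 1) * s : ℕ) * (2 ^ r) ^ 2 := by
      refine (Finset.sum_le_card_nsmul _ _ ((2 ^ r : ℝ) ^ 2) fun n _ => ?_).trans (by simp)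
      obtain ⟨h3, h4⟩ := abs_le.1 (abs_coeff_one_sub_X_pow_mul_boxPoly_le s r n)
      exact sq_le_sq' h3 h4
    rw [inv_mul_le_iff₀ hV0]
    refine h1.trans ?_
    rw [← mul_assoc]
    refine mul_le_mul_of_nonneg_right (h2.trans ?_) (sq_nonneg _)
    have e : ((r + 1) * 2 ^ r / (s : ℝ) ^ r) ^ 2 =
        (((r + 1) * s : ℕ) : ℝ) ^ 2 * (2 ^ r) ^ 2 / ((s : ℝ) ^ (r + 1)) ^ 2 := by
      push_cast
      field_simp
      ring
    rw [e, mul_div_assoc', le_div_iff₀ (by positivity)]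
    calc _ ≤ ((r + 1) * s : ℕ) * (2 ^ r) ^ 2 * (((r + 1) * s : ℕ) * V) := by gcongr
      _ = _ := by ring

end Blocks

/-! ### Transfer to `D^{-r} E` and the resulting probabilities. -/

theorem norm2_shift_mulVec_le {m : ℕ} (y : Fin m → ℝ) : norm2 ((shift m).mulVec y) ≤ norm2 y := by
  refine norm2_le_of_sq_le (norm2_nonneg y) ?_
  rw [norm2_sq]
  have e : ∀ j, (shift m).mulVec y j ^ 2 = ∑ i : Fin m, if (j : ℕ) = i + 1 then y i ^ 2 else 0 := by
    intro j
    by_cases hj : ∃ i : Fin m, (j : ℕ) = i + 1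
    · obtain ⟨i, hi⟩ := hj
      have h : ∀ x : Fin m, ((j : ℕ) = x + 1) = (x = i) := fun x => by
        rw [Fin.ext_iff]; apply propext; omega
      simp [Matrix.mulVec, dotProduct, shift, h]
    · push Not at hj
      simp [Matrix.mulVec, dotProduct, shift, hj]
  simp_rw [e]
  rw [Finset.sum_comm]
  refine Finset.sum_le_sum fun i _ => ?_
  by_cases hi : (i : ℕ) + 1 < m
  · have h : ∀ x : Fin m, ((x : ℕ) = i + 1) = (x = ⟨i + 1, hi⟩) := fun x => by
      rw [Fin.ext_iff]
    simp [h]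
  · rw [Finset.sum_eq_zero fun j _ => if_neg (by omega)]
    positivity

theorem norm2_D_pow_mulVec_le {m : ℕ} (r : ℕ) (y : Fin m → ℝ) :
    norm2 ((D m ^ r).mulVec y) ≤ 2 ^ r * norm2 y := by
  induction r with
  | zero => simp
  | succ r ih =>
    rw [pow_succ', ← Matrix.mulVec_mulVec, D_eq_one_sub_shift, Matrix.sub_mulVec, Matrix.one_mulVec,
      ← D_eq_one_sub_shift, sub_eq_add_neg]
    refine (norm2_add_le _ _).trans ?_
    rw [norm2_neg, pow_succ]
    linarith [norm2_shift_mulVec_le ((D m ^ r).mulVec y)]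

theorem le_sigmaMin_inv_D_pow_mul {r m k l : ℕ} (hk : 1 ≤ k) {E : Matrix (Fin m) (Fin k) ℝ}
    {W : Matrix (Fin l) (Fin m) ℝ} {K τ : ℝ} (hK : 0 < K) (hτ : 0 ≤ τ)
    (hW : ∀ y, norm2 (W.mulVec ((D m ^ r).mulVec y)) ≤ K * norm2 y)
    (h : ∀ z, τ * norm2 z ≤ norm2 ((W * E).mulVec z)) :
    τ / K ≤ sigmaMin ((D m ^ r)⁻¹ * E) := by
  refine le_sigmaMin hk (by positivity) fun z => ?_
  rw [div_mul_eq_mul_div, div_le_iff₀' hK]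
  refine (h z).trans (le_trans (le_of_eq ?_) (hW _))
  rw [Matrix.mulVec_mulVec, Matrix.mulVec_mulVec,
    Matrix.mul_assoc, ← Matrix.mul_assoc (D m ^ r), Matrix.mul_nonsing_inv _ (isUnit_det_D_pow m r),
    Matrix.one_mul]

section Probability

variable {Ω : Type*} [MeasurableSpace Ω] {P : Measure Ω} [IsProbabilityMeasure P]

theorem measureReal_exists_norm2_mulVec_lt_of_log_le {l m k : ℕ} (hk : 1 ≤ k) (hkm : k ≤ m)
    (hlm : l ≤ m) (hm : 1 ≤ Real.log m) (hl : 9 * k * Real.log m ≤ l)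
    {W : Matrix (Fin l) (Fin m) ℝ}
    (hW : W * W.transpose = 1) {E : Ω → Matrix (Fin m) (Fin k) ℝ}
    (hE : ∀ i j, HasLaw (fun ω => E ω i j) (gaussianReal 0 1) P)
    (hi : iIndepFun (fun (p : Fin m × Fin k) (ω : Ω) => E ω p.1 p.2) P) :
    P.real {ω | ∃ z, norm2 ((W * E ω).mulVec z) < Real.exp (-3) / 4 * √l * norm2 z} ≤
      Real.exp (-(l / 4)) := by
  obtain ⟨k, rfl⟩ : ∃ n, k = n + 1 := ⟨k - 1, by omega⟩
  -- Chosen so that `(4s)^l = e^{-3l}`, which beats the at most `e^l` grid points.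
  set s := Real.exp (-3) / 4 with hs
  have hk1 : (1 : ℝ) ≤ (k + 1 : ℕ) := by exact_mod_cast hk
  have hm1 : (1 : ℝ) ≤ m := by exact_mod_cast hk.trans hkm
  have hkm' : ((k : ℝ) + 1) ≤ m := by exact_mod_cast hkm
  have hl9 : (9 : ℝ) ≤ l := by nlinarith
  have he : Real.exp 3 ≤ 25 := by
    have h := Real.exp_one_lt_d9
    have h2 : Real.exp 3 = Real.exp 1 ^ 3 := by rw [← Real.exp_nat_mul]; norm_num
    rw [h2]
    calc Real.exp 1 ^ 3 ≤ 2.8 ^ 3 := by gcongr; linarith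
      _ ≤ 25 := by norm_num
  have hs1 : 1 / 100 ≤ s := by
    rw [hs, Real.exp_neg]
    have : (25 : ℝ)⁻¹ ≤ (Real.exp 3)⁻¹ := inv_anti₀ (Real.exp_pos _) he
    linarith
  have hspos : 0 < s := by positivity
  have hτ : s ≤ s * √l := by
    have : 1 ≤ √(l : ℝ) := Real.one_le_sqrt.2 (by linarith)
    nlinarith
  -- As `s√l ≥ 1/100`, the sum `s√l + 3m` is at most `301 m s√l`; the second factor `m` absorbs
  -- `√(k+1)`.
  have hN : 0 < 301 * m ^ 2 := by
    have : 0 < m := by omega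
    positivity
  have hcond : (s * √l + √(8 * (m * ((k : ℝ) + 1)))) * (√((k : ℝ) + 1) / (301 * m ^ 2 : ℕ)) ≤
      s * √l := by
    have h1 : √(8 * (m * ((k : ℝ) + 1))) ≤ 3 * m :=
      Real.sqrt_le_left (by positivity) |>.2 (by nlinarith)
    have h2 : √((k : ℝ) + 1) ≤ m := Real.sqrt_le_left (by positivity) |>.2 (by nlinarith)
    have h3 : s * √l + √(8 * (m * ((k : ℝ) + 1))) ≤ 301 * m * (s * √l) := by nlinarith
    rw [mul_div_assoc', div_le_iff₀ (by exact_mod_cast hN)]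
    push_cast
    calc (s * √l + √(8 * (m * ((k : ℝ) + 1)))) * √((k : ℝ) + 1)
        ≤ 301 * m * (s * √l) * m := by gcongr
      _ = _ := by ring
  refine (measureReal_exists_norm2_mulVec_lt hN hW hE hi hspos hcond).trans ?_
  have h4 : (4 * s) ^ l = Real.exp (-(3 * l)) := by
    rw [hs, mul_div_cancel₀ _ (by norm_num), ← Real.exp_nat_mul]
    congr 1; ring
  have hlog : (m : ℝ) = Real.exp (Real.log m) := (Real.exp_log (by linarith)).symm
  have h5 : (603 : ℝ) * m ^ 2 ≤ Real.exp (9 * Real.log m) := by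
    have h := Real.exp_one_gt_d9
    have h2 : (603 : ℝ) ≤ Real.exp 7 := by
      have h2 : Real.exp 7 = Real.exp 1 ^ 7 := by rw [← Real.exp_nat_mul]; norm_num
      rw [h2]
      calc (603 : ℝ) ≤ 2.7 ^ 7 := by norm_num
        _ ≤ Real.exp 1 ^ 7 := by gcongr; linarith
    have h3 : Real.exp 7 ≤ Real.exp (7 * Real.log m) := Real.exp_le_exp.2 (by linarith)
    have h6 : (m : ℝ) ^ 2 = Real.exp (2 * Real.log m) := by
      conv_lhs => rw [hlog, ← Real.exp_nat_mul]
      norm_num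
    rw [h6, show 9 * Real.log m = 7 * Real.log m + 2 * Real.log m by ring, Real.exp_add]
    gcongr
    exact h2.trans h3
  have h6 : ((k : ℝ) + 1) * (2 * (301 * m ^ 2 : ℕ) + 1) ^ k ≤ Real.exp l := by
    have h7 : ((k : ℝ) + 1) ≤ 603 * m ^ 2 := by nlinarith
    have h8 : (2 * ((301 * m ^ 2 : ℕ) : ℝ) + 1) ≤ 603 * m ^ 2 := by push_cast; nlinarith
    calc ((k : ℝ) + 1) * (2 * (301 * m ^ 2 : ℕ) + 1) ^ k
        ≤ (603 * m ^ 2) * (603 * m ^ 2) ^ k := by gcongr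
      _ = (603 * (m : ℝ) ^ 2) ^ (k + 1) := by ring
      _ ≤ Real.exp (9 * Real.log m) ^ (k + 1) := by gcongr
      _ = Real.exp (9 * (k + 1 : ℕ) * Real.log m) := by
        rw [← Real.exp_nat_mul]; congr 1; ring
      _ ≤ Real.exp l := Real.exp_le_exp.2 hl
  have h9 : Real.exp (-(m * ((k : ℝ) + 1))) ≤ Real.exp (-l) := by
    have : (l : ℝ) ≤ m := by exact_mod_cast hlm
    rw [Real.exp_le_exp]
    nlinarith
  rw [h4]
  calc Real.exp (-(m * ((k : ℝ) + 1))) +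
        ((k : ℝ) + 1) * (2 * (301 * m ^ 2 : ℕ) + 1) ^ k * Real.exp (-(3 * l))
      ≤ Real.exp (-l) + Real.exp l * Real.exp (-(3 * l)) := by gcongr
    _ = Real.exp (-l) + Real.exp (-(2 * l)) := by rw [← Real.exp_add]; ring_nf
    _ ≤ Real.exp (-l) + Real.exp (-l) := by gcongr; linarith
    _ = 2 * Real.exp (-l) := by ring
    _ ≤ Real.exp 1 * Real.exp (-l) := by
        gcongr
        have := Real.exp_one_gt_d9
        linarith
    _ ≤ Real.exp (-(l / 4)) := by
        rw [← Real.exp_add, Real.exp_le_exp]; linarith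

/-- For `m ≤ 2` the logarithm is below `1` and does not pay for the grid. A tiny constant does
instead; the grid size is `160002 = 2(1 + 4 · 20000)`. -/
theorem measureReal_exists_norm2_mulVec_lt_of_le_two {m k : ℕ} (hk : 1 ≤ k) (hkm : k ≤ m)
    (hm : m ≤ 2) {E : Ω → Matrix (Fin m) (Fin k) ℝ}
    (hE : ∀ i j, HasLaw (fun ω => E ω i j) (gaussianReal 0 1) P)
    (hi : iIndepFun (fun (p : Fin m × Fin k) (ω : Ω) => E ω p.1 p.2) P) :
    P.real {ω | ∃ z, norm2 ((E ω).mulVec z) < 1 / 20000 * √m * norm2 z} ≤ 1 / 2 := by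
  obtain ⟨k, rfl⟩ : ∃ n, k = n + 1 := ⟨k - 1, by omega⟩
  have hcond : (1 / 20000 * √m + √(8 * (m * ((k : ℝ) + 1)))) * (√((k : ℝ) + 1) / (160002 : ℕ)) ≤
      1 / 20000 * √m := by
    have hk2 : ((k : ℝ) + 1) ≤ 2 := by exact_mod_cast hkm.trans hm
    have h1 : √(8 * (m * ((k : ℝ) + 1))) ≤ 4 * √m := by
      refine Real.sqrt_le_left (by positivity) |>.2 ?_
      rw [mul_pow, Real.sq_sqrt (by positivity)]
      have : (0 : ℝ) ≤ m := by positivity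
      nlinarith
    have h2 : √((k : ℝ) + 1) ≤ 2 := Real.sqrt_le_left (by positivity) |>.2 (by linarith)
    rw [mul_div_assoc', div_le_iff₀ (by norm_num)]
    calc _ ≤ (1 / 20000 * √m + 4 * √m) * 2 := by gcongr
      _ = _ := by push_cast; ring
  have h := measureReal_exists_norm2_mulVec_lt (N := 160002) (by norm_num)
    (W := (1 : Matrix (Fin m) (Fin m) ℝ)) (by simp) hE hi (s := 1 / 20000) (by norm_num) hcond
  simp only [Matrix.one_mul] at h
  refine h.trans ?_
  have he : Real.exp (-(m * ((k : ℝ) + 1))) ≤ 2 / 5 := by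
    have h1 : (1 : ℝ) ≤ m * ((k : ℝ) + 1) := by
      have : 1 ≤ m * (k + 1) := Nat.mul_pos (by omega) (by omega)
      exact_mod_cast this
    have h2 : Real.exp (-(m * ((k : ℝ) + 1))) ≤ Real.exp (-1) := Real.exp_le_exp.2 (by linarith)
    refine h2.trans ?_
    rw [Real.exp_neg, inv_le_comm₀ (Real.exp_pos _) (by norm_num)]
    have := Real.exp_one_gt_d9
    linarith
  suffices h3 : ((k : ℝ) + 1) * (2 * (160002 : ℕ) + 1) ^ k * (4 * (1 / 20000)) ^ m ≤ 1 / 10 from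
    (add_le_add he h3).trans (by norm_num)
  have hm1 : m = 1 ∨ m = 2 := by omega
  have hk1 : k = 0 ∨ k = 1 := by omega
  rcases hm1 with rfl | rfl <;> rcases hk1 with rfl | rfl
  · norm_num
  · omega
  · norm_num
  · norm_num

theorem one_sub_le_measureReal_of_compl_subset {S B : Set Ω} (h : Sᶜ ⊆ B) {ε : ℝ}
    (hB : P.real B ≤ ε) : 1 - ε ≤ P.real S := by
  have h1 : (Set.univ : Set Ω) ⊆ S ∪ B := fun ω _ => by
    by_cases hω : ω ∈ S
    · exact Or.inl hω
    · exact Or.inr (h hω)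
  have h2 := (measureReal_mono (μ := P) h1).trans (measureReal_union_le S B)
  rw [probReal_univ] at h2
  linarith

theorem one_sub_le_measureReal_le_sigmaMin {r m k l : ℕ} (hk : 1 ≤ k)
    {E : Ω → Matrix (Fin m) (Fin k) ℝ} {W : Matrix (Fin l) (Fin m) ℝ} {K τ τ' ε : ℝ} (hK : 0 < K)
    (hτ : 0 ≤ τ) (hW : ∀ y, norm2 (W.mulVec ((D m ^ r).mulVec y)) ≤ K * norm2 y)
    (hP : P.real {ω | ∃ z, norm2 ((W * E ω).mulVec z) < τ * norm2 z} ≤ ε) (hτ' : τ' ≤ τ / K) :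
    1 - ε ≤ P.real {ω | τ' ≤ sigmaMin ((D m ^ r)⁻¹ * E ω)} := by
  refine one_sub_le_measureReal_of_compl_subset (fun ω hω => ?_) hP
  by_contra hc
  simp only [Set.mem_ofPred_eq, not_exists, not_lt] at hc
  exact hω (hτ'.trans (le_sigmaMin_inv_D_pow_mul hk hK hτ hW hc))

end Probability

/-! ### Choice of parameters and conclusion. -/

/-- Choice of the bump width `s` and of the number `l` of blocks. -/
theorem exists_block_parameters {R : ℕ} (hR : 1 ≤ R) {α : ℝ} (h0 : 0 < α) (h1 : α < 1) {m k : ℕ}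
    (hk : 1 ≤ k) (hkm : k ≤ m) {lam : ℝ} (hlam : lam = (m : ℝ) / k) (hm : 1 ≤ Real.log m)
    (h : 18 * R * Real.log m ^ (1 / (1 - α)) ≤ lam) :
    ∃ s l : ℕ, 0 < s ∧ l * (R * s) ≤ m ∧ lam ^ α / (36 * R) ≤ s ∧ (m : ℝ) / (2 * R * s) ≤ l ∧
      9 * k * Real.log m ≤ l ∧ m * lam ^ (-α) / (2 * R) ≤ l := by
  have hR' : (1 : ℝ) ≤ R := by exact_mod_cast hR
  have hk' : (1 : ℝ) ≤ k := by exact_mod_cast hk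
  have hkm' : (k : ℝ) ≤ m := by exact_mod_cast hkm
  have hlam1 : 1 ≤ lam := by rw [hlam, one_le_div (by linarith)]; exact hkm'
  have hlamk : lam * k = m := by rw [hlam]; field_simp
  have hlamm : lam ≤ m := by nlinarith
  have hα : 0 < 1 - α := by linarith
  set t := lam ^ α with ht
  have ht1 : 1 ≤ t := Real.one_le_rpow hlam1 h0.le
  have htle : t ≤ lam := by
    simpa using Real.rpow_le_rpow_of_exponent_le hlam1 h1.le
  have hp : Real.log m ≤ Real.log m ^ (1 / (1 - α)) := by
    have : 1 ≤ 1 / (1 - α) := by rw [one_le_div hα]; linarith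
    simpa using Real.rpow_le_rpow_of_exponent_le hm this
  have hlog : 18 * R * Real.log m ≤ lam := le_trans (by gcongr) h
  -- This is where the exponent `1/(1-α)` is needed: it gives `log m ≤ λ^{1-α}`.
  have htlog : t * Real.log m ≤ lam := by
    have h2 : Real.log m ^ (1 / (1 - α)) ≤ lam := by
      refine le_trans ?_ h
      have : 0 ≤ Real.log m ^ (1 / (1 - α)) := by positivity
      nlinarith
    have h3 : Real.log m ≤ lam ^ (1 - α) := by
      have := Real.rpow_le_rpow (by positivity) h2 hα.le
      rwa [← Real.rpow_mul (by linarith), one_div_mul_cancel hα.ne', Real.rpow_one] at this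
    calc t * Real.log m ≤ lam ^ α * lam ^ (1 - α) := by gcongr
      _ = lam := by rw [← Real.rpow_add (by linarith)]; simp
  -- The maximum keeps the width positive; since `s ≥ 1`, rounding down loses at most a factor `2`,
  -- whence `36 R`.
  set s := max 1 ⌊t / (18 * R)⌋₊ with hs
  have hs1 : 1 ≤ s := le_max_left _ _
  have hs1' : (1 : ℝ) ≤ s := by exact_mod_cast hs1
  have hs2 : t / (36 * R) ≤ s := by
    have h2 := Nat.lt_floor_add_one (t / (18 * R))
    have h3 : (⌊t / (18 * R)⌋₊ : ℝ) ≤ s := Nat.cast_le.2 (le_max_right _ _)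
    have h4 : t / (36 * R) = t / (18 * R) / 2 := by field_simp; norm_num
    rw [h4]; linarith
  have hs3 : (s : ℝ) = 1 ∨ (s : ℝ) ≤ t / (18 * R) := by
    rcases max_choice 1 ⌊t / (18 * R)⌋₊ with h2 | h2
    · left; rw [hs, h2]; simp
    · right; rw [hs, h2]; exact Nat.floor_le (by positivity)
  have hslog : 18 * R * s * Real.log m ≤ lam := by
    rcases hs3 with h2 | h2
    · rw [h2]; linarith
    · rw [le_div_iff₀ (by positivity)] at h2
      refine le_trans ?_ htlog
      refine mul_le_mul_of_nonneg_right (by linarith) (by linarith)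
  have hst : (s : ℝ) ≤ t := by
    rcases hs3 with h2 | h2
    · rw [h2]; exact ht1
    · refine h2.trans (div_le_self (by linarith) (by linarith))
  have hRs : R * s ≤ m := by
    have h2 : (R : ℝ) * s ≤ 18 * R * s * Real.log m := by
      have : (0 : ℝ) ≤ R * s := by positivity
      nlinarith
    have : ((R * s : ℕ) : ℝ) ≤ m := by push_cast; linarith
    exact_mod_cast this
  have hRs0 : 0 < R * s := by positivity
  have hl1 : (m : ℝ) / (2 * R * s) ≤ (m / (R * s) : ℕ) := by
    have h2 : 1 ≤ m / (R * s) := (Nat.one_le_div_iff hRs0).2 hRs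
    have h3 : m < (m / (R * s) + 1) * (R * s) := by
      rw [mul_comm]; exact Nat.lt_mul_div_succ m hRs0
    have h4 : m ≤ (m / (R * s)) * (2 * (R * s)) := by nlinarith
    rw [div_le_iff₀ (by positivity)]
    have h5 : (m : ℝ) ≤ ((m / (R * s) : ℕ) : ℝ) * (2 * (R * s)) := by exact_mod_cast h4
    linarith
  refine ⟨s, m / (R * s), by omega, Nat.div_mul_le_self _ _, hs2, hl1, le_trans ?_ hl1,
    le_trans ?_ hl1⟩
  · rw [le_div_iff₀ (by positivity)]
    nlinarith [mul_le_mul_of_nonneg_right hslog (by linarith : (0 : ℝ) ≤ k)]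
  · rw [Real.rpow_neg (by linarith), ← ht, ← div_eq_mul_inv, div_div]
    refine div_le_div_of_nonneg_left (by positivity) (by positivity) ?_
    nlinarith

/-- The lower bound for the smallest singular value resulting from the choice of parameters. -/
theorem block_lower_bound {r m s l : ℕ} (hr : 1 ≤ r) (hs : 0 < s) {t A B a : ℝ} (ht : 0 ≤ t)
    (hA : 0 < A) (hB : 0 < B) (ha : 0 ≤ a) (hts : t / A ≤ s) (hl : (m : ℝ) / (B * s) ≤ l)
    (b : ℝ) (hb : 0 < b) :
    a / (b * A ^ ((r : ℝ) - 1 / 2) * √B) * t ^ ((r : ℝ) - 1 / 2) * √m ≤ a * √l / (b / s ^ r) := by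
  have hs' : (0 : ℝ) < s := by exact_mod_cast hs
  have hr' : (0 : ℝ) ≤ (r : ℝ) - 1 / 2 := by
    have : (1 : ℝ) ≤ r := by exact_mod_cast hr
    linarith
  have h1 : t ^ ((r : ℝ) - 1 / 2) / A ^ ((r : ℝ) - 1 / 2) ≤ (s : ℝ) ^ r / √s := by
    rw [← Real.div_rpow ht hA.le, Real.sqrt_eq_rpow, ← Real.rpow_natCast, ← Real.rpow_sub hs']
    exact Real.rpow_le_rpow (by positivity) hts hr'
  have h2 : √m / (√B * √s) ≤ √l := by
    rw [← Real.sqrt_mul hB.le, ← Real.sqrt_div (by positivity)]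
    exact Real.sqrt_le_sqrt hl
  have hss : 0 < √(s : ℝ) := Real.sqrt_pos.2 hs'
  have hBs : 0 < √B := Real.sqrt_pos.2 hB
  have hAp : 0 < A ^ ((r : ℝ) - 1 / 2) := by positivity
  calc a / (b * A ^ ((r : ℝ) - 1 / 2) * √B) * t ^ ((r : ℝ) - 1 / 2) * √m
      = a / b * (t ^ ((r : ℝ) - 1 / 2) / A ^ ((r : ℝ) - 1 / 2)) * (√m / √B) := by
        field_simp
    _ ≤ a / b * ((s : ℝ) ^ r / √s) * (√m / √B) := by gcongr
    _ = a / b * (s : ℝ) ^ r * (√m / (√B * √s)) := by field_simp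
    _ ≤ a / b * (s : ℝ) ^ r * √l := by gcongr
    _ = a * √l / (b / s ^ r) := by field_simp

theorem exists_sigmaMin_bound (r : ℕ) (hr : 1 ≤ r) :
    ∃ c c' c₁ : ℝ, 0 < c ∧ 0 < c' ∧ 0 < c₁ ∧
      ∀ (α : ℝ), 0 < α → α < 1 → ∀ (m k : ℕ), 1 ≤ k → k ≤ m →
      ∀ (lam : ℝ), lam = (m : ℝ) / (k : ℝ) → c * Real.log m ^ (1 / (1 - α)) ≤ lam →
      ∀ {Ω : Type*} [MeasurableSpace Ω] (P : Measure Ω) [IsProbabilityMeasure P]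
        (E : Ω → Matrix (Fin m) (Fin k) ℝ),
        (∀ i j, HasLaw (fun ω => E ω i j) (gaussianReal 0 1) P) →
        iIndepFun (fun (p : Fin m × Fin k) (ω : Ω) => E ω p.1 p.2) P →
        1 - Real.exp (-(c' * m * lam ^ (-α))) ≤
            P.real {ω | c₁ * lam ^ (α * ((r : ℝ) - 1 / 2)) * √(m : ℝ) ≤
              sigmaMin ((D m ^ r)⁻¹ * E ω)} := by
  set R := r + 1 with hR
  have hr' : (1 : ℝ) ≤ r := by exact_mod_cast hr
  have hR1 : (1 : ℝ) ≤ R := by rw [hR]; push_cast; linarith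
  set A : ℝ := 36 * R with hA
  set B : ℝ := 2 * R with hB
  set b : ℝ := (r + 1) * 2 ^ r with hb
  have hA0 : 0 < A := by positivity
  have hB0 : 0 < B := by positivity
  have hb0 : 0 < b := by positivity
  set d : ℝ := Real.exp (-3) / 4 / (b * A ^ ((r : ℝ) - 1 / 2) * √B) with hd
  have hd0 : 0 < d := by
    have := Real.sqrt_pos.2 hB0
    positivity
  -- The second constant comes from `exp(-l/4)` with `l ≥ m λ^{-α}/(2R)`; the minimum covers the
  -- case `m ≤ 2`.
  refine ⟨18 * R, 1 / (8 * R), min d (1 / 20000 / 4 ^ r), by positivity, by positivity,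
    lt_min hd0 (by positivity), ?_⟩
  intro α hα0 hα1 m k hk hkm lam hlam hc Ω _ P _ E hE hi
  have hk' : (1 : ℝ) ≤ k := by exact_mod_cast hk
  have hkm' : (k : ℝ) ≤ m := by exact_mod_cast hkm
  have hlam1 : 1 ≤ lam := by rw [hlam, one_le_div (by linarith)]; exact hkm'
  have hlam0 : 0 < lam := by linarith
  by_cases hm : 3 ≤ m
  · have hlog : 1 ≤ Real.log m := by
      rw [Real.le_log_iff_exp_le (by linarith)]
      have h1 := Real.exp_one_lt_d9
      have h2 : (3 : ℝ) ≤ m := by exact_mod_cast hm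
      linarith
    obtain ⟨s, l, hs, hsl, hts, hl, hkl, hml⟩ :=
      exists_block_parameters (R := R) (by omega) hα0 hα1 hk hkm hlam hlog hc
    obtain ⟨W, hW, hWD⟩ := exists_orthonormal_smooth_rows r hs hsl
    have hlm : l ≤ m := (Nat.le_mul_of_pos_right l (by positivity)).trans hsl
    have hP := measureReal_exists_norm2_mulVec_lt_of_log_le hk hkm hlm hlog hkl hW hE hi
    have hs' : (0 : ℝ) < s := by exact_mod_cast hs
    refine le_trans ?_ (one_sub_le_measureReal_le_sigmaMin (r := r) hk (by positivity)
      (by positivity) hWD hP (le_trans ?_ (block_lower_bound hr hs (t := lam ^ α) (A := A) (B := B)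
        (by positivity) hA0 hB0 (by positivity) hts hl b hb0)))
    · gcongr
      calc 1 / (8 * R) * m * lam ^ (-α) = m * lam ^ (-α) / (2 * R) / 4 := by
            field_simp; norm_num
        _ ≤ l / 4 := by gcongr
    · rw [← Real.rpow_mul hlam0.le]
      gcongr
      exact min_le_left _ _
  -- Here `W = 1` and `‖D^r‖ ≤ 2^r` suffice: the required probability is at most `1/4`, and `λ ≤ 2`
  -- costs another `2^r`, hence `4^r`.
  · have hm2 : m ≤ 2 := by omega
    have hm2' : (m : ℝ) ≤ 2 := by exact_mod_cast hm2
    have hP := measureReal_exists_norm2_mulVec_lt_of_le_two hk hkm hm2 hE hi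
    refine le_trans ?_ (one_sub_le_measureReal_le_sigmaMin (r := r) (W := 1) hk (K := 2 ^ r)
      (τ := 1 / 20000 * √m) (by positivity) (by positivity)
      (fun y => by rw [Matrix.one_mulVec]; exact norm2_D_pow_mulVec_le r y)
      (by simpa only [Matrix.one_mul] using hP) ?_)
    · have h1 : 1 / (8 * (R : ℝ)) * m * lam ^ (-α) ≤ 1 / 4 := by
        have h2 : lam ^ (-α) ≤ 1 := Real.rpow_le_one_of_one_le_of_nonpos hlam1 (by linarith)
        have h3 : 1 / (8 * (R : ℝ)) ≤ 1 / 8 := by gcongr; linarith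
        calc 1 / (8 * (R : ℝ)) * m * lam ^ (-α) ≤ 1 / 8 * 2 * 1 := by gcongr
          _ = 1 / 4 := by norm_num
      have h4 := Real.add_one_le_exp (-(1 / (8 * (R : ℝ)) * m * lam ^ (-α)))
      linarith
    · have h1 : lam ^ (α * ((r : ℝ) - 1 / 2)) ≤ 2 ^ r := by
        have hlam2 : lam ≤ 2 := by
          rw [hlam]; exact (div_le_self (by linarith) hk').trans hm2'
        calc lam ^ (α * ((r : ℝ) - 1 / 2)) ≤ lam ^ (r : ℝ) :=
              Real.rpow_le_rpow_of_exponent_le hlam1 (by nlinarith)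
          _ ≤ 2 ^ (r : ℝ) := Real.rpow_le_rpow hlam0.le hlam2 (by linarith)
          _ = 2 ^ r := Real.rpow_natCast _ _
      calc min d (1 / 20000 / 4 ^ r) * lam ^ (α * ((r : ℝ) - 1 / 2)) * √m
          ≤ 1 / 20000 / 4 ^ r * 2 ^ r * √m := by
            gcongr
            exact min_le_right _ _
        _ = 1 / 20000 * √m / 2 ^ r := by
            rw [show (4 : ℝ) = 2 * 2 by norm_num, mul_pow]
            field_simp

end SigmaDelta

end

theorem theoremA (r : ℕ) (hr : 1 ≤ r) :
    ∃ c c' c₁ C : ℝ, 0 < c ∧ 0 < c' ∧ 0 < c₁ ∧ 0 < C ∧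
      ∀ (α : ℝ), 0 < α → α < 1 →
      ∀ (m k : ℕ), 1 ≤ k → k ≤ m →
      ∀ (lam : ℝ), lam = (m : ℝ) / (k : ℝ) → c * Real.log m ^ (1 / (1 - α)) ≤ lam →
      ∀ {Ω : Type*} [MeasurableSpace Ω] (P : Measure Ω) [IsProbabilityMeasure P]
        (E : Ω → Matrix (Fin m) (Fin k) ℝ),
        (∀ i j, HasLaw (fun ω => E ω i j) (gaussianReal 0 1) P) →
        iIndepFun (fun (p : Fin m × Fin k) (ω : Ω) => E ω p.1 p.2) P →
        -- the lower bound for the smallest singular value, with its probability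
        1 - Real.exp (-(c' * m * lam ^ (-α))) ≤
            P.real {ω | c₁ * lam ^ (α * ((r : ℝ) - 1 / 2)) * √(m : ℝ) ≤
              SigmaDelta.sigmaMin ((SigmaDelta.D m ^ r)⁻¹ * E ω)} ∧
        -- on that event: Sobolev duals exist and reconstruct with the claimed error
        ∀ ω, c₁ * lam ^ (α * ((r : ℝ) - 1 / 2)) * √(m : ℝ) ≤
              SigmaDelta.sigmaMin ((SigmaDelta.D m ^ r)⁻¹ * E ω) →
          SigmaDelta.IsSobolevDual r (E ω) (SigmaDelta.sobolevDual r (E ω)) ∧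
          ∀ F : Matrix (Fin k) (Fin m) ℝ, SigmaDelta.IsSobolevDual r (E ω) F →
          ∀ (δ : ℝ), 0 < δ → ∀ (x : Fin k → ℝ) (q u : Fin m → ℝ),
            SigmaDelta.IsGreedyOutput r δ ((E ω).mulVec x) q u →
            SigmaDelta.norm2 (x - F.mulVec q) ≤ C * lam ^ (-(α * ((r : ℝ) - 1 / 2))) * δ := by
  obtain ⟨c, c', c₁, hc, hc', hc₁, hmain⟩ := SigmaDelta.exists_sigmaMin_bound r hr
  -- The state has norm at most `δ√m/2`, and its `√m` cancels the one in the singular value bound.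
  refine ⟨c, c', c₁, (2 * c₁)⁻¹, hc, hc', hc₁, by positivity, ?_⟩
  intro α hα0 hα1 m k hk hkm lam hlam hcl Ω _ P _ E hE hi
  refine ⟨hmain α hα0 hα1 m k hk hkm lam hlam hcl P E hE hi, fun ω hω => ?_⟩
  have hk' : (0 : ℝ) < k := by exact_mod_cast hk
  have hm' : (0 : ℝ) < m := by exact_mod_cast lt_of_lt_of_le hk hkm
  have hlam0 : 0 < lam := by rw [hlam]; positivity
  have hsm : 0 < √(m : ℝ) := Real.sqrt_pos.2 hm'
  obtain ⟨h1, h2⟩ := SigmaDelta.sobolevDual_reconstruction hk (by positivity) hω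
  refine ⟨h1, fun F hF δ hδ x q u hu => (h2 F hF δ hδ x q u hu).trans (le_of_eq ?_)⟩
  rw [Real.rpow_neg hlam0.le]
  field_simp
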